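/- **Setting.** Let $b:[0,\infty)\to[0,\infty)$ be differentiable (one-sidedly at $0$) and non-decreasing with $b(0)=0$. Let $\nu(dx,t)$, $t\ge 0$, be measures on $(0,\infty)$ such that $\int_{(0,\infty)}(x\wedge 1)\,\nu(dx,t)<\infty$ and $\int_0^t\int_{(0,\infty)}(x\wedge 1)\,\nu(dx,s)\,ds<\infty$ for all $t\ge 0$, and such that $t\mapsto\nu(dx,t)$ is continuous in the following sense: for every bounded continuous $g:(0,\infty)\to\mathbb R$, the map $t\mapsto\int_{(0,\infty)} g(x)\,(x\wedge 1)\,\nu(dx,t)$ is continuous on $[0,\infty)$. Let $(e(s))_{s\ge 0}$ be a Poisson point process on $(0,\infty)$ with characteristic measure $\nu(dx,t)\,dt$. This means that at most one point $e(s)\in(0,\infty)$ sits at each time $s$ (with $e(s)=0$ if there is none), that the number of points $(e(s),s)$ in a Borel set $B\subseteq(0,\infty)\times[0,\infty)$ is a random variable, Poisson distributed with parameter $m(B)=\int_B\nu(dx,t)\,dt$ whenever $m(B)<\infty$, and that these numbers are independent for pairwise disjoint sets. Let $$\sigma(t)=b(t)+\sum_{0\le s\le t}e(s),\qquad t\ge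 0,$$ be the corresponding non-homogeneous subordinator, and for $0\le s\le t$ let $\mu_{s,t}$ be the law of $\sigma(t)-\sigma(s)$. Let $(T_t)_{t\ge 0}$ be a strongly continuous semigroup of linear contractions on a (real or complex) Hilbert space $\mathfrak H$, whose generator $(A,\mathrm{Dom}(A))$ is self-adjoint and dissipative, i.e. $\langle Au,u\rangle\le 0$ for all $u\in\mathrm{Dom}(A)$. **Theorem.** 1. For all $0\le s\le t$ and $u\in\mathfrak H$ the Bochner integral $$\mathcal T_{s,t}u=\int_{[0,\infty)}T_wu\,\mu_{s,t}(dw)$$ exists, and $(\mathcal T_{s,t})_{0\le s\le t}$ is a bounded propagator on $\mathfrak H$: each $\mathcal T_{s,t}$ is linear with $\|\mathcal T_{s,t}u\|\le\|u\|$; $\mathcal T_{t,t}u=u$ for $t\ge0$; $\mathcal T_{s,t}\mathcal T_{r,s}u=\mathcal T_{r,t}u$ for $0\le r\le s\le t$; and $s\mapsto\mathcal T_{s,t}u$ is norm continuous on $[0,t]$, $t\mapsto\mathcal T_{s,t}u$ is norm continuous on $[s,\infty)$, for every $u\in\mathfrak H$. 2. For every $t\ge 0$ and $q\in\mathrm{Dom}(A)$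 the integral in $$-f(-A,t)q:=b'(t)Aq+\int_{(0,\infty)}(T_xq-q)\,\nu(dx,t)$$ exists as a Bochner integral. 3. For every $s\ge 0$ and $u\in\mathrm{Dom}(A)$, the map $q(t)=\mathcal T_{s,t}u$, $t\ge s$, takes values in $\mathrm{Dom}(A)$, is differentiable in norm on $[s,\infty)$ (from the right at $t=s$), and solves $$\frac{d}{dt}q(t)=-f(-A,t)q(t),\quad t\ge s,\qquad q(s)=u .$$ -/

import Mathlib

open MeasureTheory ProbabilityTheory Set Filter Topology

noncomputable section

namespace NonhomSub

/-- The standing assumptions on the drift `b` and on the family `ν t = ν(dx, t)`, `t ≥ 0`, of measures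
on `(0, ∞)`. Only the restriction of `ν t` to `(0, ∞)` and only times `t ≥ 0` play a role. -/
structure IsAdmissible (b : ℝ → ℝ) (ν : ℝ → Measure ℝ) : Prop where
  b_zero : b 0 = 0
  b_differentiable : DifferentiableOn ℝ b (Ici 0)
  b_monotone : MonotoneOn b (Ici 0)
  /-- `∫_{(0,∞)} (x ∧ 1) ν(dx, t) < ∞` for every `t ≥ 0`. -/
  levy : ∀ t, 0 ≤ t → ∫⁻ x in Ioi 0, ENNReal.ofReal (min x 1) ∂(ν t) < ⊤
  /-- `∫_{(0,∞) × [0,t]} (x ∧ 1) ν(dx, s) ds < ∞` for every `t ≥ 0`. -/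
  levy_time : ∀ t, 0 ≤ t →
    ∫⁻ s in Icc 0 t, ∫⁻ x in Ioi 0, ENNReal.ofReal (min x 1) ∂(ν s) < ⊤
  /-- Continuity of `t ↦ ν(dx, t)`: the finite measures `(x ∧ 1) ν(dx, t)` on `(0, ∞)` depend
  weakly continuously on `t ≥ 0`, that is, their integrals of every bounded continuous `g` do. -/
  continuous : ∀ g : ℝ → ℝ, ContinuousOn g (Ioi 0) → (∃ C, ∀ x, 0 < x → |g x| ≤ C) →
    ContinuousOn (fun t => ∫ x in Ioi 0, g x * min x 1 ∂(ν t)) (Ici 0)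

/-- `m(B) = ∫_B ν(dx, t) dt` for `B ⊆ (0, ∞) × [0, ∞)` (jump size first, time second). -/
def intensity (ν : ℝ → Measure ℝ) (B : Set (ℝ × ℝ)) : ENNReal :=
  ∫⁻ t in Ici 0, ν t {x | 0 < x ∧ (x, t) ∈ B}

/-- The number of points `(e s, s)`, with `s ≥ 0` and `e s > 0`, as a counting measure on
`(0, ∞) × [0, ∞)`. The value `e s = 0` means that there is no point at time `s`. -/
def pointMeasure {Ω : Type*} (e : ℝ → Ω → ℝ) (ω : Ω) : Measure (ℝ × ℝ) :=
  Measure.sum fun s : {s : ℝ // 0 ≤ s ∧ 0 < e s ω} => Measure.dirac (e s ω, (s : ℝ))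

/-- `e` is a Poisson point process with characteristic measure `ν(dx, t) dt`: the counts of points
in Borel sets `B` are random variables, Poisson distributed with parameter `m(B)` if `m(B) < ∞`,
and independent over pairwise disjoint sets. -/
structure IsPoissonPointProcess {Ω : Type*} [MeasurableSpace Ω] (P : Measure Ω)
    (ν : ℝ → Measure ℝ) (e : ℝ → Ω → ℝ) : Prop where
  nonneg : ∀ s ω, 0 ≤ e s ω
  measurable : ∀ B, MeasurableSet B → Measurable fun ω => pointMeasure e ω B
  law : ∀ B, MeasurableSet B → intensity ν B ≠ ⊤ →
    P.map (fun ω => pointMeasure e ω B)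
      = (poissonMeasure (intensity ν B).toNNReal).map (fun k : ℕ => (k : ENNReal))
  indep : ∀ (n : ℕ) (B : Fin n → Set (ℝ × ℝ)), (∀ i, MeasurableSet (B i)) →
    Pairwise (fun i j => Disjoint (B i) (B j)) →
    iIndepFun (fun i ω => pointMeasure e ω (B i)) P

/-- The non-homogeneous subordinator `σ(t) = b(t) + ∑_{0 ≤ s ≤ t} e(s)`. -/
def subordinator {Ω : Type*} (b : ℝ → ℝ) (e : ℝ → Ω → ℝ) (t : ℝ) (ω : Ω) : ℝ :=
  b t + ∑' s : Icc (0 : ℝ) t, e s ω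

/-- `μ_{s,t}`, the law of the increment `σ(t) - σ(s)`. -/
def incrementLaw {Ω : Type*} [MeasurableSpace Ω] (P : Measure Ω) (b : ℝ → ℝ) (e : ℝ → Ω → ℝ)
    (s t : ℝ) : Measure ℝ :=
  P.map fun ω => subordinator b e t ω - subordinator b e s ω

section Operators

variable {𝕜 H : Type*} [RCLike 𝕜] [NormedAddCommGroup H] [InnerProductSpace 𝕜 H] [NormedSpace ℝ H]

/-- `T t`, `t ≥ 0`, is a strongly continuous semigroup of contractions. -/
structure IsContractionSemigroup (T : ℝ → H →L[𝕜] H) : Prop where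
  zero : ∀ u, T 0 u = u
  comp : ∀ s t, 0 ≤ s → 0 ≤ t → ∀ u, T t (T s u) = T (t + s) u
  tendsto : ∀ u, Tendsto (fun t => T t u) (𝓝[>] 0) (𝓝 u)
  contraction : ∀ t, 0 ≤ t → ∀ u, ‖T t u‖ ≤ ‖u‖

/-- `A` is the generator of `T`: `u ∈ Dom(A)` and `A u = v` exactly when `(T_t u - u) / t` converges
strongly to `v` as `t ↓ 0`. -/
def IsGenerator (T : ℝ → H →L[𝕜] H) (A : H →ₗ.[𝕜] H) : Prop :=
  ∀ u v, (u, v) ∈ A.graph ↔ Tendsto (fun t : ℝ => t⁻¹ • (T t u - u)) (𝓝[>] 0) (𝓝 v)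

/-- `⟨A u, u⟩ ≤ 0` on `Dom(A)` (for a symmetric `A` this number is real). -/
def IsDissipative (A : H →ₗ.[𝕜] H) : Prop :=
  ∀ u : A.domain, RCLike.re (inner 𝕜 (A u) (u : H)) ≤ 0

/-- `∫_{[0,∞)} T_w u μ_{s,t}(dw)` for a family of measures `μ`. -/
def subordinate (T : ℝ → H →L[𝕜] H) (μ : ℝ → ℝ → Measure ℝ) (s t : ℝ) (u : H) : H :=
  ∫ w in Ici 0, T w u ∂(μ s t)

/-- `-f(-A, t) q = b'(t) A q + ∫_{(0,∞)} (T_x q - q) ν(dx, t)` for `q ∈ Dom(A)`. The derivative of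
`b` is the one-sided one at `t = 0`. -/
def phillips (b : ℝ → ℝ) (ν : ℝ → Measure ℝ) (T : ℝ → H →L[𝕜] H) (A : H →ₗ.[𝕜] H) (t : ℝ)
    (q : A.domain) : H :=
  derivWithin b (Ici 0) t • A q + ∫ x in Ioi 0, (T x (q : H) - (q : H)) ∂(ν t)

variable (𝕜) in
/-- `U s t`, `0 ≤ s ≤ t`, is a propagator of linear operators: `U_{t,t} = 1`,
`U_{s,t} U_{r,s} = U_{r,t}` and strong continuity in each of the two parameters. -/
structure IsPropagator (U : ℝ → ℝ → H → H) : Prop where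
  map_add : ∀ s t, 0 ≤ s → s ≤ t → ∀ u v, U s t (u + v) = U s t u + U s t v
  map_smul : ∀ s t, 0 ≤ s → s ≤ t → ∀ (c : 𝕜) u, U s t (c • u) = c • U s t u
  refl : ∀ t, 0 ≤ t → ∀ u, U t t u = u
  comp : ∀ r s t, 0 ≤ r → r ≤ s → s ≤ t → ∀ u, U s t (U r s u) = U r t u
  continuous_left : ∀ t, 0 ≤ t → ∀ u, ContinuousOn (fun s => U s t u) (Icc 0 t)
  continuous_right : ∀ s, 0 ≤ s → ∀ u, ContinuousOn (fun t => U s t u) (Ici s)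

end Operators

end NonhomSub

end

/-!
The operator `𝒯_{s,t}` is the average of the semigroup `T` against the law `μ_{s,t}` of an
increment, and everything about `μ_{s,t}` is read off its Laplace transform at the natural
numbers, `∫ e^{-n w} μ_{s,t}(dw) = exp(-(Φ_n(t) - Φ_n(s)))`, where
`Φ_n(t) = n b(t) + ∫_0^t ∫ (1 - e^{-n x}) ν(dx, r) dr`. This formula
(`IsPoissonPointProcess.laplace_incrementLaw`) is the Laplace functional of a Poisson
random measure (`IsPoissonRandomMeasure.lintegral_expNeg`), applied to the jumps in `(s, t]`.

The bridge to operators is a continuity theorem (`tendsto_integral_of_tendsto_laplace`): if the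
Laplace transforms of finite measures on `[0, ∞)` converge at all natural numbers, then so do the
integrals of every bounded continuous Banach-space-valued function. The substitution `y = e^{-x}`
turns it into the Weierstrass approximation theorem on `[0, 1]`. Applied to `w ↦ T_w u` it gives

* `𝒯_{s,t} 𝒯_{r,s} = 𝒯_{r,t}`, as both sides average `T` against measures with equal Laplace
  transforms (`average_comp`);
* strong continuity, from continuity of `Φ_n` (`tendsto_subordinate`).

For the derivative let `r → t` and consider the measures `(1 - e^{-w}) μ(dw) / |r - t|`, where `μ`
is the law of the increment between `r` and `t`. Their Laplace transform at `n` is the difference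
of two difference quotients, and it converges to `Φ_{n+1}'(t) - Φ_n'(t)`, which is the Laplace
transform of `b'(t) δ₀(dw) + (1 - e^{-w}) ν(dw, t)`. For `u` in the domain of `A` the function
`G(w) = (T_w u - u) / (1 - e^{-w})`, `G(0) = A u`, is bounded and continuous on `[0, ∞)`.
Integrating it against these measures gives
`(𝒯 u - u) / |r - t| → b'(t) A u + ∫ (T_x u - u) ν(dx, t)`
(`tendsto_subordinate_quotient`): drift and jumps are treated at once. The propagator property
and the fact that `𝒯_{s,t}` commutes with `T` and `A` carry this from the diagonal to all `s ≤ t`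
(`hasDerivWithinAt_subordinate`).
-/

namespace NonhomSub

/-! ### Laplace transforms at the natural numbers and weak convergence -/

section LaplaceConvergence

variable {E : Type*} [NormedAddCommGroup E] [NormedSpace ℝ E]

/-- Vector-valued Weierstrass approximation in the variable `y = e^{-x}`, uniform on `[0, ∞)` up to
the tail `M (1 - e^{-x})^k`. The tail absorbs the possible lack of a limit of `G` at infinity: the
function `(1 - (1 - y)^k) G(-log y)` extends continuously by `0` to `y = 0`. -/
theorem exists_exp_polynomial_approx {G : ℝ → E} (hG : ContinuousOn G (Ici 0)) {M : ℝ}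
    (hM : ∀ x, 0 ≤ x → ‖G x‖ ≤ M) (k : ℕ) {ε : ℝ} (hε : 0 < ε) :
    ∃ (m : ℕ) (p : Fin m → Polynomial ℝ) (c : Fin m → E), ∀ x, 0 ≤ x →
      ‖G x - ∑ i, (p i).eval (Real.exp (-x)) • c i‖ ≤ ε + M * (1 - Real.exp (-x)) ^ k := by
  have hlog : ∀ y : unitInterval, 0 ≤ -Real.log y := fun y => by
    have := Real.log_nonpos y.2.1 y.2.2
    linarith
  have hpow : ∀ y : unitInterval, 0 ≤ 1 - (1 - (y : ℝ)) ^ k := fun y => by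
    have := pow_le_one₀ (n := k) (sub_nonneg.2 y.2.2) (by linarith [y.2.1])
    linarith
  have hF : Continuous fun y : unitInterval => (1 - (1 - (y : ℝ)) ^ k) • G (-Real.log y) := by
    rw [continuous_iff_continuousAt]
    intro y
    rcases eq_or_ne (y : ℝ) 0 with hy | hy
    · have h0 : Tendsto (fun y : unitInterval => (1 - (1 - (y : ℝ)) ^ k) * M) (𝓝 y) (𝓝 0) := by
        have : Continuous fun y : unitInterval => (1 - (1 - (y : ℝ)) ^ k) * M := by fun_prop
        simpa [hy] using this.tendsto y
      have : (fun y : unitInterval => (1 - (1 - (y : ℝ)) ^ k) • G (-Real.log y)) y = 0 := by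
        simp [hy]
      rw [ContinuousAt, show (1 - (1 - (y : ℝ)) ^ k) • G (-Real.log y) = 0 from this]
      refine squeeze_zero_norm (fun z => ?_) h0
      rw [norm_smul, Real.norm_of_nonneg (hpow z)]
      exact mul_le_mul_of_nonneg_left (hM _ (hlog z)) (hpow z)
    · refine ContinuousAt.smul (by fun_prop) ?_
      have h1 : ContinuousWithinAt G (Ici 0) (-Real.log y) := hG _ (hlog y)
      have h2 : ContinuousAt (fun z : unitInterval => -Real.log z) y :=
        ((Real.continuousAt_log hy).comp continuous_subtype_val.continuousAt).neg
      exact h1.tendsto.comp (tendsto_nhdsWithin_iff.2 ⟨h2, Eventually.of_forall hlog⟩)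
  obtain ⟨n, hn⟩ := ((Metric.tendsto_atTop.1
    (bernsteinApproximation_uniform (⟨_, hF⟩ : C(unitInterval, E)))) ε hε)
  refine ⟨n + 1, fun i => bernsteinPolynomial ℝ n i, fun i => (1 - (1 - (bernstein.z i : ℝ)) ^ k) •
    G (-Real.log (bernstein.z i)), fun x hx => ?_⟩
  have hy : Real.exp (-x) ∈ unitInterval := ⟨(Real.exp_pos _).le, by simpa using hx⟩
  have h1 := (ContinuousMap.dist_le hε.le).1 (hn n le_rfl).le ⟨_, hy⟩
  rw [dist_comm, dist_eq_norm, bernsteinApproximation.apply] at h1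
  simp only [ContinuousMap.coe_mk, Real.log_exp, neg_neg] at h1
  have hb : ∀ i : Fin (n + 1), bernstein n i ⟨_, hy⟩
      = (bernsteinPolynomial ℝ n i).eval (Real.exp (-x)) := fun i => rfl
  simp only [hb] at h1
  have h2 : ‖(1 - Real.exp (-x)) ^ k • G x‖ ≤ M * (1 - Real.exp (-x)) ^ k := by
    have h3 : 0 ≤ (1 - Real.exp (-x)) ^ k := pow_nonneg (sub_nonneg.2 hy.2) _
    rw [norm_smul, Real.norm_of_nonneg h3, mul_comm]
    exact mul_le_mul_of_nonneg_right (hM x hx) h3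
  refine le_trans (le_of_eq_of_le ?_ (norm_add_le _ _)) (add_le_add h1 h2)
  congr 1
  rw [sub_smul, one_smul]
  abel

theorem norm_exp_neg_nat_mul_le_one (n : ℕ) {x : ℝ} (hx : 0 ≤ x) :
    ‖Real.exp (-(n * x))‖ ≤ 1 := by
  have : (0 : ℝ) ≤ n * x := by positivity
  simpa [Real.norm_eq_abs] using this

theorem integrableOn_exp_neg_nat_mul (n : ℕ) (ρ : Measure ℝ) [IsFiniteMeasure ρ] :
    IntegrableOn (fun x : ℝ => Real.exp (-(n * x))) (Ici 0) ρ := by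
  refine Integrable.of_bound (C := 1) (by fun_prop) ?_
  filter_upwards [ae_restrict_mem measurableSet_Ici] with x hx
  exact norm_exp_neg_nat_mul_le_one n hx

theorem integrableOn_eval_exp (ρ : Measure ℝ) [IsFiniteMeasure ρ] (q : Polynomial ℝ) :
    IntegrableOn (fun x => q.eval (Real.exp (-x))) (Ici 0) ρ := by
  have hc : Continuous fun y : ℝ => q.eval y := q.continuous
  obtain ⟨C, hC⟩ := (isCompact_Icc (a := (0 : ℝ)) (b := 1)).exists_bound_of_continuousOn
    hc.continuousOn
  refine Integrable.of_bound (C := C) (by fun_prop) ?_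
  filter_upwards [ae_restrict_mem measurableSet_Ici] with x hx
  exact hC _ ⟨(Real.exp_pos _).le, by simpa using hx⟩

theorem tendsto_integral_eval_exp {ι : Type*} {l : Filter ι} {ρ : ι → Measure ℝ} {ρ' : Measure ℝ}
    [∀ i, IsFiniteMeasure (ρ i)] [IsFiniteMeasure ρ']
    (h : ∀ n : ℕ, Tendsto (fun i => ∫ x in Ici 0, Real.exp (-(n * x)) ∂(ρ i)) l
      (𝓝 (∫ x in Ici 0, Real.exp (-(n * x)) ∂ρ'))) (q : Polynomial ℝ) :
    Tendsto (fun i => ∫ x in Ici 0, q.eval (Real.exp (-x)) ∂(ρ i)) l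
      (𝓝 (∫ x in Ici 0, q.eval (Real.exp (-x)) ∂ρ')) := by
  induction q using Polynomial.induction_on' with
  | add p q hp hq =>
    have key : ∀ (ν : Measure ℝ) [IsFiniteMeasure ν],
        ∫ x in Ici 0, (p + q).eval (Real.exp (-x)) ∂ν
          = ∫ x in Ici 0, p.eval (Real.exp (-x)) ∂ν + ∫ x in Ici 0, q.eval (Real.exp (-x)) ∂ν := by
      intro ν _
      simp only [Polynomial.eval_add]
      exact integral_add (integrableOn_eval_exp ν p) (integrableOn_eval_exp ν q)
    simp only [key]
    exact hp.add hq
  | monomial n a =>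
    have key : ∀ x : ℝ, (Polynomial.monomial n a).eval (Real.exp (-x))
        = a * Real.exp (-(n * x)) := fun x => by
      rw [Polynomial.eval_monomial, ← Real.exp_nat_mul]
      ring_nf
    simp only [key, integral_const_mul]
    exact (h n).const_mul a

/-- Continuity theorem for Laplace transforms of finite measures on `[0, ∞)`: convergence at the
natural numbers implies convergence of the integrals of all bounded continuous functions with values
in a Banach space. No mass escapes to infinity because `∫ (1 - e^{-x})^k dρ` is a combination of
finitely many values of the Laplace transform. -/
theorem tendsto_integral_of_tendsto_laplace [CompleteSpace E] {ι : Type*} {l : Filter ι}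
    {ρ : ι → Measure ℝ}
    {ρ' : Measure ℝ} [∀ i, IsFiniteMeasure (ρ i)] [IsFiniteMeasure ρ']
    (h : ∀ n : ℕ, Tendsto (fun i => ∫ x in Ici 0, Real.exp (-(n * x)) ∂(ρ i)) l
      (𝓝 (∫ x in Ici 0, Real.exp (-(n * x)) ∂ρ')))
    {G : ℝ → E} (hG : ContinuousOn G (Ici 0)) {M : ℝ} (hM : ∀ x, 0 ≤ x → ‖G x‖ ≤ M) :
    Tendsto (fun i => ∫ x in Ici 0, G x ∂(ρ i)) l (𝓝 (∫ x in Ici 0, G x ∂ρ')) := by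
  have hpoly := fun q => tendsto_integral_eval_exp h q
  have hGint : ∀ (ν : Measure ℝ) [IsFiniteMeasure ν], IntegrableOn G (Ici 0) ν := fun ν _ => by
    refine Integrable.of_bound (C := M) (hG.aestronglyMeasurable measurableSet_Ici) ?_
    filter_upwards [ae_restrict_mem measurableSet_Ici] with x hx using hM x hx
  -- the tails `∫ (1 - e^{-x})^k` of the limit measure vanish as `k → ∞`
  have htail : Tendsto (fun k : ℕ => M * ∫ x in Ici 0, (1 - Real.exp (-x)) ^ k ∂ρ') atTop
      (𝓝 0) := by
    have : Tendsto (fun k : ℕ => ∫ x in Ici 0, (1 - Real.exp (-x)) ^ k ∂ρ') atTop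
        (𝓝 (∫ x in Ici (0 : ℝ), (0 : ℝ) ∂ρ')) := by
      refine tendsto_integral_of_dominated_convergence (fun _ => 1) (fun k => by fun_prop)
        (integrable_const _) (fun k => ?_) ?_
      · filter_upwards [ae_restrict_mem measurableSet_Ici] with x hx
        have h1 : Real.exp (-x) ≤ 1 := by simpa using hx
        have h2 := Real.exp_pos (-x)
        rw [Real.norm_of_nonneg (pow_nonneg (by linarith) _)]
        exact pow_le_one₀ (by linarith) (by linarith)
      · filter_upwards [ae_restrict_mem measurableSet_Ici] with x hx
        have h1 : Real.exp (-x) ≤ 1 := by simpa using hx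
        have h2 := Real.exp_pos (-x)
        exact tendsto_pow_atTop_nhds_zero_of_lt_one (by linarith) (by linarith)
    simpa using this.const_mul M
  rw [Metric.tendsto_nhds]
  intro δ hδ
  obtain ⟨k, hk⟩ := (htail.eventually_lt_const (show (0 : ℝ) < δ / 8 by positivity)).exists
  set ε : ℝ := δ / 8 / (ρ'.real (Ici 0) + 1) with hεdef
  have hε : 0 < ε := by positivity
  have hεm : ε * ρ'.real (Ici 0) ≤ δ / 8 := by
    have h0 : 0 ≤ ρ'.real (Ici 0) := measureReal_nonneg
    rw [hεdef, div_mul_eq_mul_div, div_le_iff₀ (by positivity)]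
    nlinarith
  obtain ⟨m, p, c, hp⟩ := exists_exp_polynomial_approx hG hM k hε
  -- the error of the approximation is a polynomial in `e^{-x}` itself
  let Q : Polynomial ℝ := Polynomial.C ε + Polynomial.C M * (1 - Polynomial.X) ^ k
  have hQ : ∀ x, Q.eval (Real.exp (-x)) = ε + M * (1 - Real.exp (-x)) ^ k := fun x => by simp [Q]
  have hbound : ∀ (ν : Measure ℝ) [IsFiniteMeasure ν],
      ‖∫ x in Ici 0, G x ∂ν - ∑ i, (∫ x in Ici 0, (p i).eval (Real.exp (-x)) ∂ν) • c i‖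
        ≤ ∫ x in Ici 0, Q.eval (Real.exp (-x)) ∂ν := fun ν _ => by
    have hS : ∑ i, (∫ x in Ici 0, (p i).eval (Real.exp (-x)) ∂ν) • c i
        = ∫ x in Ici 0, ∑ i, (p i).eval (Real.exp (-x)) • c i ∂ν := by
      rw [integral_finsetSum _ fun i _ => (integrableOn_eval_exp ν (p i)).smul_const (c i)]
      simp only [integral_smul_const]
    rw [hS, ← integral_sub (hGint ν) (integrable_finsetSum _ fun i _ =>
      (integrableOn_eval_exp ν (p i)).smul_const (c i))]
    refine norm_integral_le_of_norm_le (integrableOn_eval_exp ν Q) ?_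
    filter_upwards [ae_restrict_mem measurableSet_Ici] with x hx
    rw [hQ]
    exact hp x hx
  have hQ' : ∫ x in Ici 0, Q.eval (Real.exp (-x)) ∂ρ' < δ / 3 := by
    have hint : IntegrableOn (fun x => (1 - Real.exp (-x)) ^ k) (Ici 0) ρ' := by
      exact (integrableOn_eval_exp ρ' ((1 - Polynomial.X) ^ k)).congr_fun (fun x _ => by simp)
        measurableSet_Ici
    simp only [hQ]
    rw [integral_add (integrable_const _) (hint.const_mul M), integral_const_mul]
    simp only [integral_const, smul_eq_mul, measureReal_restrict_apply_univ]
    nlinarith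
  have hSlim : Tendsto (fun j => ∑ i, (∫ x in Ici 0, (p i).eval (Real.exp (-x)) ∂(ρ j)) • c i) l
      (𝓝 (∑ i, (∫ x in Ici 0, (p i).eval (Real.exp (-x)) ∂ρ') • c i)) :=
    tendsto_finsetSum _ fun i _ => (hpoly (p i)).smul_const (c i)
  filter_upwards [(hpoly Q).eventually_lt_const hQ',
    Metric.tendsto_nhds.1 hSlim (δ / 3) (by positivity)] with j h1 h2
  have h3 := hbound (ρ j)
  have h4 := hbound ρ'
  rw [← dist_eq_norm] at h3 h4
  rw [dist_comm] at h4
  have h5 := dist_triangle4 (∫ x in Ici 0, G x ∂(ρ j))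
    (∑ i, (∫ x in Ici 0, (p i).eval (Real.exp (-x)) ∂(ρ j)) • c i)
    (∑ i, (∫ x in Ici 0, (p i).eval (Real.exp (-x)) ∂ρ') • c i) (∫ x in Ici 0, G x ∂ρ')
  linarith

theorem integral_eq_of_laplace_eq [CompleteSpace E] {ρ ρ' : Measure ℝ} [IsFiniteMeasure ρ]
    [IsFiniteMeasure ρ']
    (h : ∀ n : ℕ, ∫ x in Ici 0, Real.exp (-(n * x)) ∂ρ = ∫ x in Ici 0, Real.exp (-(n * x)) ∂ρ')
    {G : ℝ → E} (hG : ContinuousOn G (Ici 0)) {M : ℝ} (hM : ∀ x, 0 ≤ x → ‖G x‖ ≤ M) :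
    ∫ x in Ici 0, G x ∂ρ = ∫ x in Ici 0, G x ∂ρ' :=
  tendsto_nhds_unique tendsto_const_nhds (tendsto_integral_of_tendsto_laplace
    (l := (pure () : Filter Unit)) (ρ := fun _ => ρ)
    (fun n => by rw [h n]; exact tendsto_const_nhds) hG hM)

end LaplaceConvergence

/-! ### The Laplace functional of a Poisson random measure -/

section LaplaceFunctional

/-- `e^{-a}` for `a ∈ [0, ∞]`, with `e^{-∞} = 0`. It is continuous on `[0, ∞]`, so that the Laplace
functional of a random measure makes sense without a finiteness assumption. -/
noncomputable def expNeg (a : ENNReal) : ENNReal := EReal.exp (-(a : EReal))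

theorem continuous_expNeg : Continuous expNeg :=
  ENNReal.continuous_exp.comp (continuous_neg.comp continuous_coe_ennreal_ereal)

theorem expNeg_zero : expNeg 0 = 1 := by simp [expNeg]

theorem expNeg_top : expNeg ⊤ = 0 := by simp [expNeg]

theorem expNeg_add (a b : ENNReal) : expNeg (a + b) = expNeg a * expNeg b := by
  rw [expNeg, expNeg, expNeg, ← EReal.exp_add, EReal.coe_ennreal_add, EReal.neg_add
    (.inl (EReal.coe_ennreal_ne_bot _)) (.inr (EReal.coe_ennreal_ne_bot _)), sub_eq_add_neg]

theorem expNeg_le_one (a : ENNReal) : expNeg a ≤ 1 := by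
  rw [expNeg, EReal.exp_le_one_iff, EReal.neg_le, neg_zero]
  exact EReal.coe_ennreal_nonneg a

theorem expNeg_ofReal {x : ℝ} (hx : 0 ≤ x) :
    expNeg (ENNReal.ofReal x) = ENNReal.ofReal (Real.exp (-x)) := by
  rw [expNeg, EReal.coe_ennreal_ofReal, max_eq_left hx, ← EReal.coe_neg, EReal.exp_coe]

theorem antitone_expNeg : Antitone expNeg := fun a b h => by
  rw [expNeg, expNeg, EReal.exp_le_exp_iff, EReal.neg_le_neg_iff]
  exact EReal.coe_ennreal_le_coe_ennreal_iff.2 h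

theorem expNeg_lt_one {a : ENNReal} (ha : a ≠ 0) : expNeg a < 1 := by
  refine lt_of_le_of_ne (expNeg_le_one a) fun h => ha ?_
  rw [expNeg, ← EReal.exp_zero] at h
  have := EReal.exp_strictMono.injective h
  simpa using this

theorem expNeg_sum {ι : Type*} (s : Finset ι) (a : ι → ENNReal) :
    expNeg (∑ i ∈ s, a i) = ∏ i ∈ s, expNeg (a i) := by
  induction s using Finset.cons_induction with
  | empty => simp [expNeg_zero]
  | cons j s hj ih => rw [Finset.sum_cons, Finset.prod_cons, expNeg_add, ih]

/-- The Laplace transform of the Poisson distribution. -/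
theorem lintegral_expNeg_poisson (r : NNReal) {c : ENNReal} (hc : c ≠ ⊤) :
    ∫⁻ k : ℕ, expNeg (c * k) ∂(poissonMeasure r) = expNeg ((1 - expNeg c) * r) := by
  obtain ⟨c, rfl⟩ : ∃ c' : NNReal, c = c' := ⟨c.toNNReal, (ENNReal.coe_toNNReal hc).symm⟩
  have h1 : ∀ k : ℕ, expNeg (c * k) = ENNReal.ofReal (Real.exp (-c) ^ k) := fun k => by
    rw [← Real.exp_nat_mul, show (c : ENNReal) * k = ENNReal.ofReal (k * c) by
      rw [ENNReal.ofReal_mul (by positivity)]; simp [mul_comm], expNeg_ofReal (by positivity)]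
    ring_nf
  have h2 : expNeg c = ENNReal.ofReal (Real.exp (-c)) := by
    simpa using h1 1
  have h3 : HasSum (fun n : ℕ => Real.exp (-r) * r ^ n / n.factorial * Real.exp (-c) ^ n)
      (Real.exp (-((1 - Real.exp (-c)) * r))) := by
    have := (NormedSpace.expSeries_div_hasSum_exp (𝔸 := ℝ) ((r : ℝ) * Real.exp (-c))).mul_left
      (Real.exp (-r))
    rw [← Real.exp_eq_exp_ℝ, ← Real.exp_add] at this
    rw [show -((1 - Real.exp (-c)) * r) = -(r : ℝ) + r * Real.exp (-c) by ring]
    refine this.congr_fun fun n => ?_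
    rw [mul_pow]
    ring
  have h4 : (0 : ℝ) ≤ 1 - Real.exp (-c) := by simp
  have h5 : (1 - expNeg c) * (r : ENNReal) = ENNReal.ofReal ((1 - Real.exp (-c)) * r) := by
    rw [h2, ← ENNReal.ofReal_one, ← ENNReal.ofReal_sub _ (Real.exp_pos _).le,
      ENNReal.ofReal_mul h4, ENNReal.ofReal_coe_nnreal]
  rw [h5, expNeg_ofReal (by positivity), poissonMeasure, lintegral_sum_measure]
  simp only [lintegral_smul_measure, lintegral_dirac, h1, smul_eq_mul]
  rw [← h3.tsum_eq, ENNReal.ofReal_tsum_of_nonneg (fun n => by positivity) h3.summable]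
  congr 1
  ext n
  rw [← ENNReal.ofReal_mul (by positivity)]

variable {Ω X : Type*} [MeasurableSpace Ω] [MeasurableSpace X]

/-- `N` is a Poisson random measure with mean measure `lam`: the mass of a measurable set of finite
`lam`-measure is Poisson distributed, and the masses of disjoint sets are independent. -/
structure IsPoissonRandomMeasure (P : Measure Ω) (lam : Measure X) (N : Ω → Measure X) : Prop where
  measurable : Measurable N
  law : ∀ B, MeasurableSet B → lam B ≠ ⊤ →
    P.map (fun ω => N ω B) = (poissonMeasure (lam B).toNNReal).map (fun k : ℕ => (k : ENNReal))
  indep : ∀ (n : ℕ) (B : Fin n → Set X), (∀ i, MeasurableSet (B i)) →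
    Pairwise (fun i j => Disjoint (B i) (B j)) → iIndepFun (fun i ω => N ω (B i)) P

variable {P : Measure Ω} {lam : Measure X} {N : Ω → Measure X}

theorem IsPoissonRandomMeasure.measurable_apply (h : IsPoissonRandomMeasure P lam N) {B : Set X}
    (hB : MeasurableSet B) : Measurable fun ω => N ω B :=
  (Measure.measurable_coe hB).comp h.measurable

theorem IsPoissonRandomMeasure.lintegral_expNeg_apply [IsProbabilityMeasure P]
    (h : IsPoissonRandomMeasure P lam N) {B : Set X} (hB : MeasurableSet B)
    {c : ENNReal} (hc : c ≠ ⊤) (hcB : c ≠ 0 → lam B ≠ ⊤) :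
    ∫⁻ ω, expNeg (c * N ω B) ∂P = expNeg ((1 - expNeg c) * lam B) := by
  rcases eq_or_ne c 0 with rfl | hc0
  · simp [expNeg_zero]
  have hm : Measurable fun a : ENNReal => expNeg (c * a) :=
    continuous_expNeg.measurable.comp (measurable_const_mul c)
  rw [← lintegral_map hm (h.measurable_apply hB), h.law B hB (hcB hc0),
    lintegral_map hm (by fun_prop), lintegral_expNeg_poisson _ hc, ENNReal.coe_toNNReal (hcB hc0)]

theorem IsPoissonRandomMeasure.lintegral_expNeg_simpleFunc [IsProbabilityMeasure P]
    (h : IsPoissonRandomMeasure P lam N) (f : SimpleFunc X ENNReal)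
    (hf : ∀ x, f x ≠ ⊤) (hlam : ∀ c, c ≠ 0 → lam (f ⁻¹' {c}) ≠ ⊤) :
    ∫⁻ ω, expNeg (∫⁻ x, f x ∂(N ω)) ∂P = expNeg (∫⁻ x, (1 - expNeg (f x)) ∂lam) := by
  let n := f.range.card
  let v : Fin n ≃ f.range := f.range.equivFin.symm
  have hsum : ∀ F : ENNReal → ENNReal, ∑ c ∈ f.range, F c = ∑ i, F (v i) := fun F => by
    rw [← Finset.sum_coe_sort, ← v.sum_comp]
  have hB : ∀ i, MeasurableSet (f ⁻¹' {(v i : ENNReal)}) := fun i => f.measurableSet_fiber _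
  have hind := h.indep n (fun i => f ⁻¹' {(v i : ENNReal)}) hB fun i j hij =>
    Disjoint.preimage _ (by
      rw [disjoint_singleton]
      exact fun e => hij (v.injective (Subtype.ext e)))
  have hv : ∀ i, (v i : ENNReal) ≠ ⊤ := fun i => by
    obtain ⟨x, hx⟩ := SimpleFunc.mem_range.1 (v i).2
    rw [← hx]; exact hf x
  have hl : ∀ ω, expNeg (∫⁻ x, f x ∂(N ω)) = ∏ i, expNeg (v i * N ω (f ⁻¹' {(v i : ENNReal)})) :=
    fun ω => by
      rw [SimpleFunc.lintegral_eq_lintegral, SimpleFunc.lintegral, hsum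
        (fun c => c * N ω (f ⁻¹' {c})), expNeg_sum]
  have hr : ∫⁻ x, (1 - expNeg (f x)) ∂lam
      = ∑ i, (1 - expNeg (v i)) * lam (f ⁻¹' {(v i : ENNReal)}) := by
    rw [← hsum (fun c => (1 - expNeg c) * lam (f ⁻¹' {c})), ← SimpleFunc.map_lintegral
      (fun c => 1 - expNeg c), ← SimpleFunc.lintegral_eq_lintegral]
    rfl
  simp only [hl]
  rw [lintegral_prod_eq_prod_lintegral_of_indepFun Finset.univ
    (fun i ω => expNeg (v i * N ω (f ⁻¹' {(v i : ENNReal)})))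
    (hind.comp (fun i a => expNeg (v i * a)) fun i =>
      continuous_expNeg.measurable.comp (measurable_const_mul _))
    (fun i => continuous_expNeg.measurable.comp ((h.measurable_apply (hB i)).const_mul _)),
    hr, expNeg_sum]
  exact Finset.prod_congr rfl fun i _ => h.lintegral_expNeg_apply (hB i) (hv i) (hlam _)

/-- The Laplace functional of a Poisson random measure,
`E exp(-∫ f dN) = exp(-∫ (1 - e^{-f}) dlam)`. -/
theorem IsPoissonRandomMeasure.lintegral_expNeg [IsProbabilityMeasure P]
    (h : IsPoissonRandomMeasure P lam N)
    {f : X → ENNReal} (hf : Measurable f) (hfin : ∫⁻ x, (1 - expNeg (f x)) ∂lam ≠ ⊤) :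
    ∫⁻ ω, expNeg (∫⁻ x, f x ∂(N ω)) ∂P = expNeg (∫⁻ x, (1 - expNeg (f x)) ∂lam) := by
  have hcont : Continuous fun a => 1 - expNeg a :=
    ENNReal.continuous_sub_left ENNReal.one_ne_top |>.comp continuous_expNeg
  have hmeas : Measurable fun x => 1 - expNeg (f x) := hcont.measurable.comp hf
  have hlefun : ∀ n x, SimpleFunc.eapprox f n x ≤ f x := fun n x => by
    rw [← SimpleFunc.iSup_eapprox_apply hf x]
    exact le_iSup (fun n => SimpleFunc.eapprox f n x) n
  have hn : ∀ n, ∫⁻ ω, expNeg (∫⁻ x, SimpleFunc.eapprox f n x ∂(N ω)) ∂P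
      = expNeg (∫⁻ x, (1 - expNeg (SimpleFunc.eapprox f n x)) ∂lam) := fun n => by
    refine h.lintegral_expNeg_simpleFunc _ (fun x => (SimpleFunc.eapprox_lt_top f n x).ne) ?_
    intro c hc
    -- Markov's inequality for `1 - e^{-f}`: the approximants have level sets of finite measure
    have hpos : 1 - expNeg c ≠ 0 := (tsub_pos_of_lt (expNeg_lt_one hc)).ne'
    have hle : (1 - expNeg c) * lam (SimpleFunc.eapprox f n ⁻¹' {c})
        ≤ ∫⁻ x, (1 - expNeg (f x)) ∂lam := by
      refine le_trans (mul_le_mul_right (measure_mono fun x hx => ?_) _)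
        (mul_meas_ge_le_lintegral hmeas (1 - expNeg c))
      have hx' : SimpleFunc.eapprox f n x = c := hx
      exact tsub_le_tsub_left (antitone_expNeg (hx' ▸ hlefun n x)) 1
    intro htop
    rw [htop, ENNReal.mul_top hpos] at hle
    exact hfin (top_le_iff.1 hle)
  have hlim1 : Tendsto (fun n => ∫⁻ ω, expNeg (∫⁻ x, SimpleFunc.eapprox f n x ∂(N ω)) ∂P) atTop
      (𝓝 (∫⁻ ω, expNeg (∫⁻ x, f x ∂(N ω)) ∂P)) := by
    refine tendsto_lintegral_of_dominated_convergence (fun _ => 1) (fun n => ?_)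
      (fun n => Eventually.of_forall fun ω => expNeg_le_one _) (by simp)
      (Eventually.of_forall fun ω => (continuous_expNeg.tendsto _).comp ?_)
    · exact continuous_expNeg.measurable.comp ((Measure.measurable_lintegral
        (SimpleFunc.eapprox f n).measurable).comp h.measurable)
    · exact lintegral_tendsto_of_tendsto_of_monotone
        (fun n => (SimpleFunc.eapprox f n).measurable.aemeasurable)
        (Eventually.of_forall fun x n m hnm => SimpleFunc.monotone_eapprox f hnm x)
        (Eventually.of_forall fun x => SimpleFunc.tendsto_eapprox hf x)
  have hlim2 : Tendsto (fun n => expNeg (∫⁻ x, (1 - expNeg (SimpleFunc.eapprox f n x)) ∂lam)) atTop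
      (𝓝 (expNeg (∫⁻ x, (1 - expNeg (f x)) ∂lam))) := by
    refine (continuous_expNeg.tendsto _).comp (lintegral_tendsto_of_tendsto_of_monotone
      (fun n => (hcont.measurable.comp (SimpleFunc.eapprox f n).measurable).aemeasurable)
      (Eventually.of_forall fun x n m hnm => ?_)
      (Eventually.of_forall fun x => (hcont.tendsto _).comp (SimpleFunc.tendsto_eapprox hf x)))
    exact tsub_le_tsub_left (antitone_expNeg (SimpleFunc.monotone_eapprox f hnm x)) 1
  simp only [hn] at hlim1
  exact tendsto_nhds_unique hlim1 hlim2

/-- The integral `∫ f dN` is almost surely finite: its Laplace transform `E exp(-a ∫ f dN)` tends to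
`P(∫ f dN < ∞)` and to `1` as `a → 0`. -/
theorem IsPoissonRandomMeasure.ae_lintegral_lt_top [IsProbabilityMeasure P]
    (h : IsPoissonRandomMeasure P lam N) {f : X → ENNReal} (hf : Measurable f)
    (hf_top : ∀ x, f x ≠ ⊤) (hfin : ∫⁻ x, (1 - expNeg (f x)) ∂lam ≠ ⊤) :
    ∀ᵐ ω ∂P, ∫⁻ x, f x ∂(N ω) < ⊤ := by
  have hcont : Continuous fun a => 1 - expNeg a :=
    ENNReal.continuous_sub_left ENNReal.one_ne_top |>.comp continuous_expNeg
  let a : ℕ → ENNReal := fun k => ((k : ENNReal) + 1)⁻¹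
  have ha1 : ∀ k, a k ≤ 1 := fun k => by simp [a]
  have ha0 : ∀ k, a k ≠ 0 := fun k => by simp [a]
  have ha : Tendsto a atTop (𝓝 0) := by
    have := (tendsto_add_atTop_iff_nat (f := fun k : ℕ => ((k : ENNReal))⁻¹) 1).2
      ENNReal.tendsto_inv_nat_nhds_zero
    simpa [a] using this
  have hle : ∀ k x, 1 - expNeg (a k * f x) ≤ 1 - expNeg (f x) := fun k x =>
    tsub_le_tsub_left (antitone_expNeg (mul_le_of_le_one_left' (ha1 k))) 1
  have hL : ∀ k, ∫⁻ ω, expNeg (a k * ∫⁻ x, f x ∂(N ω)) ∂P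
      = expNeg (∫⁻ x, (1 - expNeg (a k * f x)) ∂lam) := fun k => by
    rw [← h.lintegral_expNeg (hf.const_mul _) ((lintegral_mono (hle k)).trans_lt hfin.lt_top).ne]
    simp only [lintegral_const_mul _ hf]
  have hXm : Measurable fun ω => ∫⁻ x, f x ∂(N ω) :=
    (Measure.measurable_lintegral hf).comp h.measurable
  have hset : MeasurableSet {ω | ∫⁻ x, f x ∂(N ω) < ⊤} := measurableSet_lt hXm measurable_const
  have hub : ∀ k, expNeg (∫⁻ x, (1 - expNeg (a k * f x)) ∂lam)
      ≤ P {ω | ∫⁻ x, f x ∂(N ω) < ⊤} := fun k => by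
    rw [← hL, ← lintegral_indicator_one hset]
    refine lintegral_mono fun ω => ?_
    by_cases hω : ∫⁻ x, f x ∂(N ω) < ⊤
    · rw [indicator_of_mem (show ω ∈ {ω | ∫⁻ x, f x ∂(N ω) < ⊤} from hω)]
      exact expNeg_le_one _
    · rw [not_lt, top_le_iff] at hω
      simp [hω, ENNReal.mul_top (ha0 k), expNeg_top]
  have hlim : Tendsto (fun k => expNeg (∫⁻ x, (1 - expNeg (a k * f x)) ∂lam)) atTop (𝓝 1) := by
    suffices h0 : Tendsto (fun k => ∫⁻ x, (1 - expNeg (a k * f x)) ∂lam) atTop (𝓝 0) by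
      simpa [expNeg_zero, Function.comp_def] using (continuous_expNeg.tendsto _).comp h0
    rw [← lintegral_zero (μ := lam)]
    refine tendsto_lintegral_of_dominated_convergence _
      (fun k => hcont.measurable.comp (hf.const_mul _))
      (fun k => Eventually.of_forall (hle k)) hfin (Eventually.of_forall fun x => ?_)
    have h1 : Tendsto (fun k => a k * f x) atTop (𝓝 0) := by
      simpa using ENNReal.Tendsto.mul_const ha (.inr (hf_top x))
    simpa [expNeg_zero, Function.comp_def] using (hcont.tendsto _).comp h1
  have h1 : 1 ≤ P {ω | ∫⁻ x, f x ∂(N ω) < ⊤} := le_of_tendsto' hlim hub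
  exact (prob_compl_eq_zero_iff hset).2 (le_antisymm prob_le_one h1)

end LaplaceFunctional

/-! ### The laws of the increments of the subordinator -/

section Levy

variable {b : ℝ → ℝ} {ν : ℝ → Measure ℝ}

theorem IsAdmissible.integrableOn_min (hν : IsAdmissible b ν) {t : ℝ} (ht : 0 ≤ t) :
    IntegrableOn (fun x => min x 1) (Ioi 0) (ν t) := by
  refine ⟨by fun_prop, ?_⟩
  rw [hasFiniteIntegral_iff_ofReal]
  · exact hν.levy t ht
  · filter_upwards [ae_restrict_mem measurableSet_Ioi] with x hx
    exact le_min (le_of_lt hx) zero_le_one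

/-- The finite measure `(x ∧ 1) ν(dx, t)` on `(0, ∞)`, extended by `0` to negative times. -/
noncomputable def weightedLevy (ν : ℝ → Measure ℝ) (t : ℝ) : Measure ℝ :=
  if 0 ≤ t then ((ν t).restrict (Ioi 0)).withDensity fun x => ENNReal.ofReal (min x 1) else 0

theorem weightedLevy_apply {t : ℝ} (ht : 0 ≤ t) {C : Set ℝ} (hC : MeasurableSet C) :
    weightedLevy ν t C
      = ∫⁻ x in Ioi 0, C.indicator (fun x => ENNReal.ofReal (min x 1)) x ∂(ν t) := by
  rw [weightedLevy, if_pos ht, withDensity_apply _ hC, lintegral_indicator hC]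

theorem IsAdmissible.isFiniteMeasure_weightedLevy (hν : IsAdmissible b ν) (t : ℝ) :
    IsFiniteMeasure (weightedLevy ν t) := by
  rcases le_or_gt 0 t with ht | ht
  · exact ⟨by simpa [weightedLevy_apply ht MeasurableSet.univ] using hν.levy t ht⟩
  · rw [weightedLevy, if_neg (not_le.2 ht)]
    infer_instance

/-- Weak continuity in time gives measurability in time, as the indicators of `(a, ∞)` are
increasing limits of bounded continuous functions. -/
theorem IsAdmissible.measurable_weightedLevy (hν : IsAdmissible b ν) :
    Measurable (weightedLevy ν) := by
  have := hν.isFiniteMeasure_weightedLevy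
  have hIoi : ∀ a : ℝ, Measurable fun t => weightedLevy ν t (Ioi a) := fun a => by
    let g : ℕ → ℝ → ℝ := fun n x => min 1 (n * max (x - a) 0)
    have hg0 : ∀ n x, 0 ≤ g n x := fun n x => le_min zero_le_one (by positivity)
    have hgc : ∀ n, Continuous (g n) := fun n => by fun_prop
    have hg1 : ∀ n x, |g n x| ≤ 1 := fun n x => by
      rw [abs_of_nonneg (hg0 n x)]; exact min_le_left _ _
    have hgm : ∀ x, Monotone fun n => g n x := fun x n m hnm => by
      exact min_le_min_left 1 (mul_le_mul_of_nonneg_right (by exact_mod_cast hnm)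
        (le_max_right _ _))
    have hglim : ∀ x, Tendsto (fun n => g n x) atTop (𝓝 ((Ioi a).indicator 1 x)) := fun x => by
      by_cases hx : x ∈ Ioi a
      · have hx' : 0 < x - a := sub_pos.2 hx
        obtain ⟨N, hN⟩ := exists_nat_gt (1 / (x - a))
        refine tendsto_atTop_of_eventually_const (i₀ := N) fun n hn => ?_
        rw [indicator_of_mem hx, Pi.one_apply]
        refine min_eq_left ?_
        rw [max_eq_left hx'.le]
        rw [div_lt_iff₀ hx'] at hN
        have : (N : ℝ) ≤ n := by exact_mod_cast hn
        nlinarith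
      · have hx' : x - a ≤ 0 := sub_nonpos.2 (not_lt.1 hx)
        simp [g, max_eq_right hx', indicator_of_notMem hx]
    have hmeas : ∀ n, Measurable fun t => if 0 ≤ t then
        ENNReal.ofReal (∫ x in Ioi 0, g n x * min x 1 ∂(ν t)) else 0 := fun n => by
      have h1 := hν.continuous (g n) (hgc n).continuousOn ⟨1, fun x _ => hg1 n x⟩
      have h2 := h1.measurable_piecewise (g := fun _ => 0) continuousOn_const measurableSet_Ici
      convert h2.ennreal_ofReal using 1
      ext t
      by_cases ht : 0 ≤ t <;> simp [piecewise, ht]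
    refine measurable_of_tendsto_metrizable hmeas (tendsto_pi_nhds.2 fun t => ?_)
    by_cases ht : 0 ≤ t
    · have hint := fun n => (hν.integrableOn_min ht).bdd_mul (f := g n)
        (hgc n).aestronglyMeasurable (Eventually.of_forall fun x => hg1 n x)
      simp only [ht, if_true]
      have hval : ∀ n, ENNReal.ofReal (∫ x in Ioi 0, g n x * min x 1 ∂(ν t))
          = ∫⁻ x in Ioi 0, ENNReal.ofReal (g n x * min x 1) ∂(ν t) := fun n => by
        refine ofReal_integral_eq_lintegral_ofReal (hint n) ?_
        filter_upwards [ae_restrict_mem measurableSet_Ioi] with x hx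
        exact mul_nonneg (hg0 n x) (le_min (le_of_lt hx) zero_le_one)
      simp only [hval]
      rw [weightedLevy_apply ht measurableSet_Ioi]
      refine lintegral_tendsto_of_tendsto_of_monotone (fun n => by fun_prop) ?_ ?_
      · filter_upwards [ae_restrict_mem measurableSet_Ioi] with x hx n m hnm
        exact ENNReal.ofReal_le_ofReal (mul_le_mul_of_nonneg_right (hgm x hnm)
          (le_min (le_of_lt hx) zero_le_one))
      · refine Eventually.of_forall fun x => ?_
        have h3 := (ENNReal.continuous_ofReal.tendsto _).comp ((hglim x).mul_const (min x 1))
        have h4 : (Ioi a).indicator (fun x => ENNReal.ofReal (min x 1)) x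
            = ENNReal.ofReal ((Ioi a).indicator 1 x * min x 1) := by
          by_cases hx : a < x <;> simp [hx]
        rw [h4]
        exact h3
    · simp [ht, weightedLevy]
  refine Measurable.measure_of_isPiSystem (borel_eq_generateFrom_Ioi ℝ ▸ BorelSpace.measurable_eq)
    isPiSystem_Ioi (fun s hs => ?_) ?_
  · obtain ⟨a, rfl⟩ := hs
    exact hIoi a
  · convert hIoi 0 using 2 with t
    by_cases ht : 0 ≤ t
    · rw [weightedLevy_apply ht MeasurableSet.univ, weightedLevy_apply ht measurableSet_Ioi,
        lintegral_indicator measurableSet_Ioi, indicator_univ, Measure.restrict_restrict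
        measurableSet_Ioi, inter_self]
    · simp [weightedLevy, ht]

/-- `ν(dx, t)` is recovered from the measurable family `(x ∧ 1) ν(dx, t)` by dividing by the density
`x ∧ 1`, which is positive on `(0, ∞)`. -/
theorem IsAdmissible.aemeasurable_restrict (hν : IsAdmissible b ν) {I : Set ℝ}
    (hI : MeasurableSet I) (hI0 : I ⊆ Ici 0) :
    AEMeasurable (fun t => (ν t).restrict (Ioi 0)) (volume.restrict I) := by
  have hw : Measurable fun x : ℝ => (ENNReal.ofReal (min x 1))⁻¹ := by fun_prop
  refine ⟨fun t => (weightedLevy ν t).withDensity fun x => (ENNReal.ofReal (min x 1))⁻¹, ?_, ?_⟩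
  · refine Measure.measurable_of_measurable_coe _ fun C hC => ?_
    simp only [withDensity_apply _ hC, ← lintegral_indicator hC]
    exact (Measure.measurable_lintegral (hw.indicator hC)).comp hν.measurable_weightedLevy
  · filter_upwards [ae_restrict_mem hI] with t ht
    have ht0 : 0 ≤ t := hI0 ht
    rw [weightedLevy, if_pos ht0, withDensity_inv_same (by fun_prop)]
    · filter_upwards [ae_restrict_mem measurableSet_Ioi] with x hx
      simpa using hx
    · exact Eventually.of_forall fun x => ENNReal.ofReal_ne_top

/-- `ψ_n(t) = ∫_{(0,∞)} (1 - e^{-n x}) ν(dx, t)`. -/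
noncomputable def levyExponent (ν : ℝ → Measure ℝ) (n : ℕ) (t : ℝ) : ℝ :=
  ∫ x in Ioi 0, (1 - Real.exp (-(n * x))) ∂(ν t)

theorem one_sub_exp_le_mul_min (n : ℕ) {x : ℝ} (hx : 0 ≤ x) :
    1 - Real.exp (-(n * x)) ≤ (n + 1) * min x 1 := by
  have h1 := Real.add_one_le_exp (-(n * x))
  have h2 := Real.exp_pos (-(n * x))
  have h3 : (0 : ℝ) ≤ n := Nat.cast_nonneg n
  rcases le_total x 1 with h | h
  · rw [min_eq_left h]; nlinarith
  · rw [min_eq_right h]; nlinarith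

theorem one_sub_exp_nonneg (n : ℕ) {x : ℝ} (hx : 0 ≤ x) : 0 ≤ 1 - Real.exp (-(n * x)) := by
  have : (0 : ℝ) ≤ n * x := by positivity
  simpa using this

theorem IsAdmissible.integrableOn_one_sub_exp (hν : IsAdmissible b ν) (n : ℕ) {t : ℝ}
    (ht : 0 ≤ t) : IntegrableOn (fun x => 1 - Real.exp (-(n * x))) (Ioi 0) (ν t) := by
  refine ((hν.integrableOn_min ht).const_mul ((n : ℝ) + 1)).mono' (by fun_prop) ?_
  filter_upwards [ae_restrict_mem measurableSet_Ioi] with x hx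
  rw [Real.norm_of_nonneg (one_sub_exp_nonneg n (le_of_lt hx))]
  exact one_sub_exp_le_mul_min n (le_of_lt hx)

theorem IsAdmissible.continuousOn_levyExponent (hν : IsAdmissible b ν) (n : ℕ) :
    ContinuousOn (levyExponent ν n) (Ici 0) := by
  have hpos : ∀ x : ℝ, 0 < x → 0 < min x 1 := fun x hx => lt_min hx one_pos
  refine (hν.continuous (fun x => (1 - Real.exp (-(n * x))) / min x 1) ?_
    ⟨n + 1, fun x hx => ?_⟩).congr fun t _ => ?_
  · exact ContinuousOn.div (by fun_prop) (by fun_prop) fun x hx => (hpos x hx).ne'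
  · rw [abs_of_nonneg (div_nonneg (one_sub_exp_nonneg n hx.le) (hpos x hx).le),
      div_le_iff₀ (hpos x hx)]
    exact one_sub_exp_le_mul_min n hx.le
  · refine setIntegral_congr_fun measurableSet_Ioi fun x hx => ?_
    exact (div_mul_cancel₀ _ (hpos x hx).ne').symm

theorem levyExponent_nonneg (n : ℕ) (t : ℝ) : 0 ≤ levyExponent ν n t :=
  setIntegral_nonneg measurableSet_Ioi fun _ hx => one_sub_exp_nonneg n (le_of_lt hx)

/-- The intensity of the jumps in the time window `I`, as a measure on the jump sizes. -/
noncomputable def windowIntensity (ν : ℝ → Measure ℝ) (I : Set ℝ) : Measure ℝ :=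
  (volume.restrict I).bind fun t => (ν t).restrict (Ioi 0)

theorem IsAdmissible.windowIntensity_apply (hν : IsAdmissible b ν) {I : Set ℝ}
    (hI : MeasurableSet I) (hI0 : I ⊆ Ici 0) {C : Set ℝ} (hC : MeasurableSet C) :
    windowIntensity ν I C = intensity ν (C ×ˢ I) := by
  rw [windowIntensity, Measure.bind_apply hC (hν.aemeasurable_restrict hI hI0), intensity]
  have : ∀ t, ν t {x | 0 < x ∧ (x, t) ∈ C ×ˢ I}
      = I.indicator (fun t => (ν t).restrict (Ioi 0) C) t := fun t => by
    by_cases ht : t ∈ I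
    · rw [indicator_of_mem ht, Measure.restrict_apply hC]
      congr 1
      ext x
      simp [ht, and_comm]
    · simp [ht]
  simp only [this]
  rw [lintegral_indicator hI, Measure.restrict_restrict hI, inter_eq_self_of_subset_left hI0]

theorem IsAdmissible.integrableOn_levyExponent (hν : IsAdmissible b ν) (n : ℕ) {I : Set ℝ} {R : ℝ}
    (hIR : I ⊆ Icc 0 R) : IntegrableOn (levyExponent ν n) I :=
  (((hν.continuousOn_levyExponent n).mono Icc_subset_Ici_self).integrableOn_Icc).mono_set hIR

theorem one_sub_expNeg_ofReal (n : ℕ) {x : ℝ} (hx : 0 ≤ x) :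
    1 - expNeg (n * ENNReal.ofReal x) = ENNReal.ofReal (1 - Real.exp (-(n * x))) := by
  rw [show (n : ENNReal) * ENNReal.ofReal x = ENNReal.ofReal (n * x) by
    rw [ENNReal.ofReal_mul (by positivity), ENNReal.ofReal_natCast], expNeg_ofReal (by positivity),
    ← ENNReal.ofReal_one, ← ENNReal.ofReal_sub _ (Real.exp_pos _).le]

theorem IsAdmissible.lintegral_windowIntensity (hν : IsAdmissible b ν) (n : ℕ) {I : Set ℝ} {R : ℝ}
    (hI : MeasurableSet I) (hIR : I ⊆ Icc 0 R) :
    ∫⁻ x, (1 - expNeg (n * ENNReal.ofReal x)) ∂(windowIntensity ν I)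
      = ENNReal.ofReal (∫ t in I, levyExponent ν n t) := by
  have hm : Measurable fun x : ℝ => 1 - expNeg (n * ENNReal.ofReal x) :=
    measurable_const.sub (continuous_expNeg.measurable.comp (by fun_prop))
  rw [windowIntensity, Measure.lintegral_bind
    (hν.aemeasurable_restrict hI (hIR.trans Icc_subset_Ici_self)) hm.aemeasurable,
    ofReal_integral_eq_lintegral_ofReal (hν.integrableOn_levyExponent n hIR)
    (Eventually.of_forall fun t => levyExponent_nonneg n t)]
  refine setLIntegral_congr_fun hI fun t ht => ?_
  rw [levyExponent, ofReal_integral_eq_lintegral_ofReal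
    (hν.integrableOn_one_sub_exp n (hIR ht).1)]
  · exact setLIntegral_congr_fun measurableSet_Ioi fun x hx => one_sub_expNeg_ofReal n (le_of_lt hx)
  · filter_upwards [ae_restrict_mem measurableSet_Ioi] with x hx
    exact one_sub_exp_nonneg n (le_of_lt hx)

end Levy

section Subordinator

variable {Ω : Type*} {b : ℝ → ℝ} {e : ℝ → Ω → ℝ}

/-- The sizes of the jumps in the time window `I`, as a counting measure. -/
noncomputable def windowPoints (e : ℝ → Ω → ℝ) (I : Set ℝ) (ω : Ω) : Measure ℝ :=
  ((pointMeasure e ω).restrict (univ ×ˢ I)).map Prod.fst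

theorem windowPoints_apply {I : Set ℝ} {C : Set ℝ} (hC : MeasurableSet C) (ω : Ω) :
    windowPoints e I ω C = pointMeasure e ω (C ×ˢ I) := by
  rw [windowPoints, Measure.map_apply measurable_fst hC,
    Measure.restrict_apply (measurable_fst hC)]
  congr 1
  ext p
  simp

/-- The sum of the jumps in the time window `I`. -/
noncomputable def jumpSum (e : ℝ → Ω → ℝ) (I : Set ℝ) (ω : Ω) : ENNReal :=
  ∑' s : I, ENNReal.ofReal (e s ω)

/-- The points with `e s ω = 0` are absent from `windowPoints`, but contribute nothing to the
sum. -/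
theorem jumpSum_eq_lintegral {I : Set ℝ} (hI : MeasurableSet I) (hI0 : I ⊆ Ici 0) (ω : Ω) :
    jumpSum e I ω = ∫⁻ x, ENNReal.ofReal x ∂(windowPoints e I ω) := by
  have hm : Measurable fun p : ℝ × ℝ => (univ ×ˢ I).indicator (fun p => ENNReal.ofReal p.1) p :=
    (ENNReal.measurable_ofReal.comp measurable_fst).indicator (MeasurableSet.univ.prod hI)
  rw [windowPoints, lintegral_map ENNReal.measurable_ofReal measurable_fst,
    ← lintegral_indicator (MeasurableSet.univ.prod hI), pointMeasure, lintegral_sum_measure]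
  simp only [lintegral_dirac' _ hm]
  rw [jumpSum, tsum_subtype I (fun s => ENNReal.ofReal (e s ω))]
  refine Eq.trans ?_ (tsum_subtype {s : ℝ | 0 ≤ s ∧ 0 < e s ω}
      (fun s => (univ ×ˢ I).indicator (fun p : ℝ × ℝ => ENNReal.ofReal p.1) (e s ω, s))).symm
  congr 1
  ext s
  by_cases hs : s ∈ I
  · have h0 : 0 ≤ s := hI0 hs
    by_cases hp : 0 < e s ω
    · simp [hs, h0, hp]
    · simp [hs, hp, not_lt.1 hp]
  · by_cases hp : s ∈ {s : ℝ | 0 ≤ s ∧ 0 < e s ω} <;> simp [hs, indicator]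

/-- This holds also where the sum of the jumps diverges: both the real `tsum` and `ENNReal.toReal`
are then `0`. -/
theorem subordinator_eq (h0 : ∀ s ω, 0 ≤ e s ω) (t : ℝ) (ω : Ω) :
    subordinator b e t ω = b t + (jumpSum e (Icc 0 t) ω).toReal := by
  rw [subordinator, jumpSum, ENNReal.tsum_toReal_eq fun _ => ENNReal.ofReal_ne_top]
  simp only [ENNReal.toReal_ofReal (h0 _ ω)]

theorem jumpSum_Icc {s t : ℝ} (hs : 0 ≤ s) (hst : s ≤ t) (ω : Ω) :
    jumpSum e (Icc 0 t) ω = jumpSum e (Icc 0 s) ω + jumpSum e (Ioc s t) ω := by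
  have hd : Disjoint (Icc 0 s) (Ioc s t) := by
    rw [Set.disjoint_left]
    exact fun x hx hx' => not_le.2 hx'.1 hx.2
  rw [← Icc_union_Ioc_eq_Icc hs hst]
  exact ENNReal.summable.tsum_union_disjoint (f := fun s => ENNReal.ofReal (e s ω)) hd
    ENNReal.summable

variable [MeasurableSpace Ω] {P : Measure Ω} {ν : ℝ → Measure ℝ}

theorem IsPoissonPointProcess.isPoissonRandomMeasure_windowPoints
    (he : IsPoissonPointProcess P ν e) (hν : IsAdmissible b ν) {I : Set ℝ}
    (hI : MeasurableSet I) (hI0 : I ⊆ Ici 0) :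
    IsPoissonRandomMeasure P (windowIntensity ν I) (windowPoints e I) where
  measurable := by
    refine Measure.measurable_of_measurable_coe _ fun C hC => ?_
    simp only [windowPoints_apply hC]
    exact he.measurable _ (hC.prod hI)
  law C hC hfin := by
    rw [hν.windowIntensity_apply hI hI0 hC] at hfin ⊢
    simp only [windowPoints_apply hC]
    exact he.law _ (hC.prod hI) hfin
  indep n B hB hdisj := by
    simp only [windowPoints_apply (hB _)]
    exact he.indep n (fun i => B i ×ˢ I) (fun i => (hB i).prod hI)
      fun i j hij => Disjoint.set_prod_left (hdisj hij) _ _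

theorem IsPoissonPointProcess.measurable_jumpSum (he : IsPoissonPointProcess P ν e)
    (hν : IsAdmissible b ν) {I : Set ℝ} (hI : MeasurableSet I) (hI0 : I ⊆ Ici 0) :
    Measurable (jumpSum e I) := by
  simp only [funext (jumpSum_eq_lintegral (e := e) hI hI0)]
  exact (Measure.measurable_lintegral ENNReal.measurable_ofReal).comp
    (he.isPoissonRandomMeasure_windowPoints hν hI hI0).measurable

variable [IsProbabilityMeasure P]

theorem IsPoissonPointProcess.ae_jumpSum_lt_top (he : IsPoissonPointProcess P ν e)
    (hν : IsAdmissible b ν) {I : Set ℝ} {R : ℝ} (hI : MeasurableSet I) (hIR : I ⊆ Icc 0 R) :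
    ∀ᵐ ω ∂P, jumpSum e I ω < ⊤ := by
  have hI0 := hIR.trans Icc_subset_Ici_self
  simp only [jumpSum_eq_lintegral (e := e) hI hI0]
  refine (he.isPoissonRandomMeasure_windowPoints hν hI hI0).ae_lintegral_lt_top
    ENNReal.measurable_ofReal (fun _ => ENNReal.ofReal_ne_top) ?_
  have := hν.lintegral_windowIntensity 1 hI hIR
  simp only [Nat.cast_one, one_mul] at this
  rw [this]
  exact ENNReal.ofReal_ne_top

theorem IsPoissonPointProcess.lintegral_expNeg_jumpSum (he : IsPoissonPointProcess P ν e)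
    (hν : IsAdmissible b ν) {I : Set ℝ} {R : ℝ} (hI : MeasurableSet I) (hIR : I ⊆ Icc 0 R)
    (n : ℕ) : ∫⁻ ω, expNeg (n * jumpSum e I ω) ∂P
      = ENNReal.ofReal (Real.exp (-∫ t in I, levyExponent ν n t)) := by
  have hI0 := hIR.trans Icc_subset_Ici_self
  have hl := hν.lintegral_windowIntensity n hI hIR
  have := (he.isPoissonRandomMeasure_windowPoints hν hI hI0).lintegral_expNeg
    (f := fun x => n * ENNReal.ofReal x) (by fun_prop) (by rw [hl]; exact ENNReal.ofReal_ne_top)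
  rw [hl, expNeg_ofReal (setIntegral_nonneg hI fun t _ => levyExponent_nonneg n t)] at this
  rw [← this]
  simp only [lintegral_const_mul _ ENNReal.measurable_ofReal, jumpSum_eq_lintegral (e := e) hI hI0]

theorem IsPoissonPointProcess.ae_increment_eq (he : IsPoissonPointProcess P ν e)
    (hν : IsAdmissible b ν) {s t : ℝ} (hs : 0 ≤ s) (hst : s ≤ t) :
    (fun ω => subordinator b e t ω - subordinator b e s ω)
      =ᵐ[P] fun ω => b t - b s + (jumpSum e (Ioc s t) ω).toReal := by
  filter_upwards [he.ae_jumpSum_lt_top hν measurableSet_Icc (Subset.refl (Icc 0 t))] with ω hω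
  rw [jumpSum_Icc hs hst, ENNReal.add_lt_top] at hω
  rw [subordinator_eq he.nonneg, subordinator_eq he.nonneg, jumpSum_Icc hs hst,
    ENNReal.toReal_add hω.1.ne hω.2.ne]
  ring

theorem IsPoissonPointProcess.aemeasurable_increment (he : IsPoissonPointProcess P ν e)
    (hν : IsAdmissible b ν) {s t : ℝ} (hs : 0 ≤ s) (hst : s ≤ t) :
    AEMeasurable (fun ω => subordinator b e t ω - subordinator b e s ω) P :=
  ⟨_, (he.measurable_jumpSum hν measurableSet_Ioc
    fun _ hr => hs.trans hr.1.le).ennreal_toReal.const_add (b t - b s),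
    he.ae_increment_eq hν hs hst⟩

theorem IsPoissonPointProcess.isProbabilityMeasure_incrementLaw
    (he : IsPoissonPointProcess P ν e) (hν : IsAdmissible b ν) {s t : ℝ} (hs : 0 ≤ s)
    (hst : s ≤ t) : IsProbabilityMeasure (incrementLaw P b e s t) :=
  Measure.isProbabilityMeasure_map (he.aemeasurable_increment hν hs hst)

theorem IsPoissonPointProcess.incrementLaw_restrict (he : IsPoissonPointProcess P ν e)
    (hν : IsAdmissible b ν) {s t : ℝ} (hs : 0 ≤ s) (hst : s ≤ t) :
    (incrementLaw P b e s t).restrict (Ici 0) = incrementLaw P b e s t := by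
  refine Measure.restrict_eq_self_of_ae_mem ?_
  refine (ae_map_iff (he.aemeasurable_increment hν hs hst) measurableSet_Ici).2 ?_
  filter_upwards [he.ae_increment_eq hν hs hst] with ω hω
  rw [hω]
  have := hν.b_monotone hs (hs.trans hst : (0 : ℝ) ≤ t) hst
  have h2 := ENNReal.toReal_nonneg (a := jumpSum e (Ioc s t) ω)
  linarith

/-- `Φ_n(t) = n b(t) + ∫_0^t ψ_n(r) dr`, the Laplace exponent of `σ(t)` at `n`. -/
noncomputable def laplaceExponent (b : ℝ → ℝ) (ν : ℝ → Measure ℝ) (n : ℕ) (t : ℝ) : ℝ :=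
  n * b t + ∫ r in (0 : ℝ)..t, levyExponent ν n r

/-- Besides its support in `[0, ∞)`, this formula is all that the rest of the argument uses of the
law `μ_{s,t}`. -/
theorem IsPoissonPointProcess.laplace_incrementLaw (he : IsPoissonPointProcess P ν e)
    (hν : IsAdmissible b ν) {s t : ℝ} (hs : 0 ≤ s) (hst : s ≤ t) (n : ℕ) :
    ∫ x in Ici 0, Real.exp (-(n * x)) ∂(incrementLaw P b e s t)
      = Real.exp (-(laplaceExponent b ν n t - laplaceExponent b ν n s)) := by
  have hII : ∀ r, 0 ≤ r → IntervalIntegrable (levyExponent ν n) volume 0 r := fun r hr =>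
    (intervalIntegrable_iff_integrableOn_Ioc_of_le hr).2
      (hν.integrableOn_levyExponent n Ioc_subset_Icc_self)
  have hsub : Ioc s t ⊆ Icc 0 t := fun r hr => ⟨hs.trans hr.1.le, hr.2⟩
  have hX := he.measurable_jumpSum hν (measurableSet_Ioc (a := s) (b := t))
    (hsub.trans Icc_subset_Ici_self)
  have hJ : ∫ ω, Real.exp (-(n * (jumpSum e (Ioc s t) ω).toReal)) ∂P
      = Real.exp (-∫ r in Ioc s t, levyExponent ν n r) := by
    have hm : AEStronglyMeasurable
        (fun ω => Real.exp (-(n * (jumpSum e (Ioc s t) ω).toReal))) P :=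
      (Real.measurable_exp.comp (hX.ennreal_toReal.const_mul _).neg).aestronglyMeasurable
    rw [integral_eq_lintegral_of_nonneg_ae (Eventually.of_forall fun ω => (Real.exp_pos _).le) hm]
    rw [← ENNReal.toReal_ofReal (Real.exp_pos (-∫ r in Ioc s t, levyExponent ν n r)).le,
      ← he.lintegral_expNeg_jumpSum hν measurableSet_Ioc hsub n]
    congr 1
    refine lintegral_congr_ae ?_
    filter_upwards [he.ae_jumpSum_lt_top hν measurableSet_Ioc hsub] with ω hω
    rw [← expNeg_ofReal (by positivity), ENNReal.ofReal_mul (by positivity),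
      ENNReal.ofReal_natCast, ENNReal.ofReal_toReal hω.ne]
  rw [he.incrementLaw_restrict hν hs hst, incrementLaw, integral_map
    (he.aemeasurable_increment hν hs hst) (by fun_prop)]
  refine (integral_congr_ae ((he.ae_increment_eq hν hs hst).fun_comp
    fun x => Real.exp (-(n * x)))).trans ?_
  simp only [Function.comp_def, mul_add, neg_add, Real.exp_add, integral_const_mul, hJ]
  rw [← Real.exp_add]
  congr 1
  rw [laplaceExponent, laplaceExponent, ← intervalIntegral.integral_of_le hst,
    ← intervalIntegral.integral_interval_sub_left (hII t (hs.trans hst)) (hII s hs)]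
  ring

end Subordinator

/-! ### Averages of a contraction semigroup -/

section Average

variable {𝕜 H : Type*} [RCLike 𝕜] [NormedAddCommGroup H] [InnerProductSpace 𝕜 H]
  {T : ℝ → H →L[𝕜] H} {A : H →ₗ.[𝕜] H}

theorem IsContractionSemigroup.norm_sub_le (hT : IsContractionSemigroup T) {s t : ℝ} (hs : 0 ≤ s)
    (ht : 0 ≤ t) (u : H) : ‖T t u - T s u‖ ≤ ‖T |t - s| u - u‖ := by
  wlog h : s ≤ t generalizing s t
  · rw [norm_sub_rev, abs_sub_comm]
    exact this ht hs (le_of_not_ge h)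
  have h0 : 0 ≤ t - s := sub_nonneg.2 h
  rw [abs_of_nonneg h0, show T t u = T s (T (t - s) u) by
    rw [hT.comp _ _ h0 hs, add_sub_cancel], ← map_sub]
  exact hT.contraction s hs _

theorem IsContractionSemigroup.continuousOn (hT : IsContractionSemigroup T) (u : H) :
    ContinuousOn (fun w => T w u) (Ici 0) := by
  intro t ht
  have h0 : Tendsto (fun r => T r u) (𝓝[≥] 0) (𝓝 u) := by
    rw [← Ioi_insert, nhdsWithin_insert, tendsto_sup]
    refine ⟨?_, hT.tendsto u⟩
    have := tendsto_pure_nhds (fun r => T r u) 0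
    rwa [hT.zero] at this
  have h1 : Tendsto (fun s : ℝ => |s - t|) (𝓝[Ici 0] t) (𝓝[≥] 0) := by
    refine tendsto_nhdsWithin_iff.2 ⟨?_, Eventually.of_forall fun s => abs_nonneg (s - t)⟩
    have : Continuous fun s : ℝ => |s - t| := by fun_prop
    simpa using (this.tendsto t).mono_left nhdsWithin_le_nhds
  rw [ContinuousWithinAt, tendsto_iff_norm_sub_tendsto_zero]
  refine squeeze_zero' (Eventually.of_forall fun _ => norm_nonneg _) ?_
    ((tendsto_iff_norm_sub_tendsto_zero.1 h0).comp h1)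
  filter_upwards [self_mem_nhdsWithin] with s hs
  exact hT.norm_sub_le ht hs u

theorem IsContractionSemigroup.integrableOn (hT : IsContractionSemigroup T) (μ : Measure ℝ)
    [IsFiniteMeasure μ] (u : H) : IntegrableOn (fun w => T w u) (Ici 0) μ := by
  refine Integrable.of_bound (C := ‖u‖)
    ((hT.continuousOn u).aestronglyMeasurable measurableSet_Ici) ?_
  filter_upwards [ae_restrict_mem measurableSet_Ici] with x hx using hT.contraction x hx u

variable [NormedSpace ℝ H]

/-- The difference quotient `(T_x u - u) / (1 - e^{-x})`, continuously extended by `A u = v`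
to `x = 0`. -/
noncomputable def generatorQuotient (T : ℝ → H →L[𝕜] H) (u v : H) (x : ℝ) : H :=
  if x = 0 then v else (1 - Real.exp (-x))⁻¹ • (T x u - u)

theorem smul_generatorQuotient (hT : IsContractionSemigroup T) (u v : H) (x : ℝ) :
    (1 - Real.exp (-x)) • generatorQuotient T u v x = T x u - u := by
  rw [generatorQuotient]
  split_ifs with h
  · simp [h, hT.zero]
  · have : 1 - Real.exp (-x) ≠ 0 := by
      rw [sub_ne_zero]
      exact fun h' => h (by simpa using h'.symm)
    rw [smul_inv_smul₀ this]

theorem hasDerivAt_one_sub_exp_neg : HasDerivAt (fun x : ℝ => 1 - Real.exp (-x)) 1 0 := by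
  simpa using ((hasDerivAt_neg (0 : ℝ)).exp).const_sub 1

theorem tendsto_div_one_sub_exp :
    Tendsto (fun x : ℝ => (1 - Real.exp (-x))⁻¹ * x) (𝓝[≠] 0) (𝓝 1) := by
  have := (hasDerivAt_iff_tendsto_slope.1 hasDerivAt_one_sub_exp_neg).inv₀ one_ne_zero
  rw [inv_one] at this
  refine this.congr fun x => ?_
  simp [slope_def_field, mul_comm, div_eq_mul_inv]

/-- Continuity at `0` is the statement that `(u, v)` belongs to the graph of the generator. -/
theorem continuousOn_generatorQuotient (hT : IsContractionSemigroup T) {u v : H}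
    (h : Tendsto (fun t : ℝ => t⁻¹ • (T t u - u)) (𝓝[>] 0) (𝓝 v)) :
    ContinuousOn (generatorQuotient T u v) (Ici 0) := by
  intro x hx
  rcases eq_or_lt_of_le (show (0 : ℝ) ≤ x from hx) with rfl | hx0
  · have h0 : generatorQuotient T u v 0 = v := if_pos rfl
    rw [ContinuousWithinAt, h0, ← Ioi_insert, nhdsWithin_insert, tendsto_sup]
    refine ⟨?_, ?_⟩
    · have := tendsto_pure_nhds (generatorQuotient T u v) 0
      rwa [h0] at this
    · have h1 := (tendsto_div_one_sub_exp.mono_left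
        (nhdsWithin_mono 0 fun x (hx : 0 < x) => hx.ne')).smul h
      rw [one_smul] at h1
      refine h1.congr' ?_
      filter_upwards [self_mem_nhdsWithin] with x hx
      have hx' : x ≠ 0 := ne_of_gt hx
      rw [generatorQuotient, if_neg hx', smul_smul, mul_assoc, mul_inv_cancel₀ hx', mul_one]
  · have h1 : ContinuousWithinAt (fun x => (1 - Real.exp (-x))⁻¹ • (T x u - u)) (Ici 0) x := by
      refine ContinuousWithinAt.smul (ContinuousAt.continuousWithinAt ?_)
        (((hT.continuousOn u) x hx).sub continuousWithinAt_const)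
      refine ContinuousAt.inv₀ (by fun_prop) ?_
      have : Real.exp (-x) < 1 := by simpa using hx0
      linarith
    refine h1.congr_of_eventuallyEq ?_ (if_neg hx0.ne')
    filter_upwards [nhdsWithin_le_nhds (lt_mem_nhds hx0)] with y hy
    exact if_neg hy.ne'

theorem exists_bound_generatorQuotient (hT : IsContractionSemigroup T) {u v : H}
    (h : Tendsto (fun t : ℝ => t⁻¹ • (T t u - u)) (𝓝[>] 0) (𝓝 v)) :
    ∃ M, ∀ x, 0 ≤ x → ‖generatorQuotient T u v x‖ ≤ M := by
  obtain ⟨C, hC⟩ := (isCompact_Icc (a := (0 : ℝ)) (b := 1)).exists_bound_of_continuousOn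
    ((continuousOn_generatorQuotient hT h).mono Icc_subset_Ici_self)
  have he : 0 < 1 - Real.exp (-1) := by simp
  refine ⟨max C ((1 - Real.exp (-1))⁻¹ * (2 * ‖u‖)), fun x hx => ?_⟩
  rcases le_total x 1 with hx1 | hx1
  · exact (hC x ⟨hx, hx1⟩).trans (le_max_left _ _)
  · refine le_trans ?_ (le_max_right _ _)
    have hle : 1 - Real.exp (-1) ≤ 1 - Real.exp (-x) :=
      sub_le_sub_left (Real.exp_le_exp.2 (neg_le_neg hx1)) 1
    rw [generatorQuotient, if_neg (by linarith), norm_smul, norm_inv,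
      Real.norm_of_nonneg (he.le.trans hle)]
    refine mul_le_mul (inv_anti₀ he hle) ?_ (norm_nonneg _) (inv_nonneg.2 he.le)
    have := norm_sub_le (T x u) u
    have := hT.contraction x hx u
    linarith

theorem IsAdmissible.integrableOn_semigroup_sub {b : ℝ → ℝ} {ν : ℝ → Measure ℝ}
    (hν : IsAdmissible b ν) (hT : IsContractionSemigroup T) {u v : H}
    (h : Tendsto (fun t : ℝ => t⁻¹ • (T t u - u)) (𝓝[>] 0) (𝓝 v)) {t : ℝ} (ht : 0 ≤ t) :
    IntegrableOn (fun x => T x u - u) (Ioi 0) (ν t) := by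
  obtain ⟨M, hM⟩ := exists_bound_generatorQuotient hT h
  have hexp := (hν.integrableOn_one_sub_exp 1 ht).mul_const M
  refine hexp.mono' ((((hT.continuousOn u).mono Ioi_subset_Ici_self).sub
    continuousOn_const).aestronglyMeasurable measurableSet_Ioi) ?_
  filter_upwards [ae_restrict_mem measurableSet_Ioi] with x hx
  have h0 := one_sub_exp_nonneg 1 (le_of_lt hx)
  simp only [Nat.cast_one, one_mul] at h0 ⊢
  rw [← smul_generatorQuotient hT u v x, norm_smul, Real.norm_of_nonneg h0]
  exact mul_le_mul_of_nonneg_left (hM x (le_of_lt hx)) h0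

variable [IsScalarTower ℝ 𝕜 H]

/-- The average `u ↦ ∫_{[0,∞)} T_w u μ(dw)` of the semigroup against a probability measure. -/
noncomputable def average (hT : IsContractionSemigroup T) (μ : Measure ℝ) [IsProbabilityMeasure μ] :
    H →L[𝕜] H :=
  LinearMap.mkContinuous
    { toFun := fun u => ∫ w in Ici 0, T w u ∂μ
      map_add' := fun u v => by
        simp only [map_add]
        exact integral_add (hT.integrableOn μ u) (hT.integrableOn μ v)
      map_smul' := fun c u => by
        simp only [map_smul, RingHom.id_apply]
        exact integral_smul c _ } 1 fun u => by
    rw [one_mul]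
    refine (norm_integral_le_of_norm_le_const (μ := μ.restrict (Ici 0)) (C := ‖u‖) ?_).trans ?_
    · filter_upwards [ae_restrict_mem measurableSet_Ici] with x hx using hT.contraction x hx u
    · exact mul_le_of_le_one_right (norm_nonneg u) (by
        rw [measureReal_restrict_apply_univ]; exact measureReal_le_one)

variable (hT : IsContractionSemigroup T) (μ : Measure ℝ) [IsProbabilityMeasure μ]

theorem average_apply (u : H) : average hT μ u = ∫ w in Ici 0, T w u ∂μ := rfl

theorem norm_average_le (u : H) : ‖average hT μ u‖ ≤ ‖u‖ := by
  simpa using (average hT μ).le_of_opNorm_le (LinearMap.mkContinuous_norm_le _ zero_le_one _) u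

variable [CompleteSpace H]

theorem average_commute {t : ℝ} (ht : 0 ≤ t) (u : H) :
    T t (average hT μ u) = average hT μ (T t u) := by
  rw [average_apply, average_apply,
    ← ContinuousLinearMap.integral_comp_comm _ (hT.integrableOn μ u)]
  refine setIntegral_congr_fun measurableSet_Ici fun w hw => ?_
  rw [hT.comp w t hw ht, hT.comp t w ht hw, add_comm]

/-- Averages commute with the semigroup, hence with its difference quotients, hence with its
generator. -/
theorem average_mem_graph (hA : IsGenerator T A) {u v : H} (h : (u, v) ∈ A.graph) :
    (average hT μ u, average hT μ v) ∈ A.graph := by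
  rw [hA] at h ⊢
  refine (((average hT μ).continuous.tendsto v).comp h).congr' ?_
  filter_upwards [self_mem_nhdsWithin] with t ht
  rw [Function.comp_apply, average_commute hT μ (le_of_lt ht), ← map_sub]
  exact LinearMap.map_smul_of_tower (average hT μ : H →ₗ[𝕜] H) _ _

/-- The product of two averages is the average against the convolution, which is identified through
its Laplace transform. -/
theorem average_comp {ρ ρ' : Measure ℝ} [IsProbabilityMeasure ρ] [IsProbabilityMeasure ρ']
    (hμ : μ.restrict (Ici 0) = μ) (hρ : ρ.restrict (Ici 0) = ρ)
    (h : ∀ n : ℕ, ∫ x in Ici 0, Real.exp (-(n * x)) ∂ρ'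
      = (∫ x in Ici 0, Real.exp (-(n * x)) ∂μ) * ∫ x in Ici 0, Real.exp (-(n * x)) ∂ρ) (u : H) :
    average hT μ (average hT ρ u) = average hT ρ' u := by
  have hconv : (μ ∗ ρ).restrict (Ici 0) = μ ∗ ρ := by
    refine Measure.restrict_eq_self_of_ae_mem ?_
    refine (ae_map_iff (by fun_prop) measurableSet_Ici).2 ?_
    rw [← hμ, ← hρ, Measure.prod_restrict]
    filter_upwards [ae_restrict_mem (measurableSet_Ici.prod measurableSet_Ici)] with p hp
    exact add_nonneg hp.1 hp.2
  have hl : ∀ n : ℕ, ∫ x in Ici 0, Real.exp (-(n * x)) ∂(μ ∗ ρ)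
      = ∫ x in Ici 0, Real.exp (-(n * x)) ∂ρ' := fun n => by
    have hi := integrableOn_exp_neg_nat_mul n (μ ∗ ρ)
    rw [h n]
    rw [IntegrableOn, hconv] at hi
    rw [hconv, hμ, hρ, integral_conv hi]
    simp only [mul_add, neg_add, Real.exp_add, integral_const_mul, integral_mul_const]
  have hi := hT.integrableOn (μ ∗ ρ) u
  rw [average_apply, average_apply hT ρ', ← integral_eq_of_laplace_eq hl (hT.continuousOn u)
    (M := ‖u‖) fun x hx => hT.contraction x hx u]
  rw [IntegrableOn, hconv] at hi
  rw [hconv, integral_conv hi]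
  conv_rhs => rw [← hμ]
  refine setIntegral_congr_fun measurableSet_Ici fun w hw => ?_
  rw [average_apply, ← ContinuousLinearMap.integral_comp_comm _ (hT.integrableOn ρ u)]
  conv_rhs => rw [← hρ]
  refine setIntegral_congr_fun measurableSet_Ici fun x hx => ?_
  exact hT.comp x w hx hw u

end Average

section Exponent

variable {b : ℝ → ℝ} {ν : ℝ → Measure ℝ}

theorem IsAdmissible.hasDerivWithinAt_laplaceExponent (hν : IsAdmissible b ν) (n : ℕ) {t : ℝ}
    (ht : 0 ≤ t) : HasDerivWithinAt (laplaceExponent b ν n)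
      (n * derivWithin b (Ici 0) t + levyExponent ν n t) (Ici 0) t := by
  refine ((hν.b_differentiable t ht).hasDerivWithinAt.const_mul (n : ℝ)).add ?_
  -- extend the integrand continuously to negative times
  have hc : Continuous fun r => levyExponent ν n (max r 0) :=
    (hν.continuousOn_levyExponent n).comp_continuous (by fun_prop) fun r => le_max_right r 0
  have h1 := ((hc.integral_hasStrictDerivAt 0 t).hasDerivAt).hasDerivWithinAt (s := Ici 0)
  rw [max_eq_left ht] at h1
  refine h1.congr_of_mem (fun r hr => ?_) ht
  refine intervalIntegral.integral_congr fun x hx => ?_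
  rw [uIcc_of_le hr] at hx
  simp only [max_eq_left hx.1]

/-- The Laplace exponents determine the first-order behaviour of the Laplace transforms of the
increments, on both sides of `t`. -/
theorem IsAdmissible.tendsto_laplaceExponent_quotient (hν : IsAdmissible b ν) (n : ℕ) {t : ℝ}
    (ht : 0 ≤ t) {l : Filter ℝ} (hl : l ≤ 𝓝[Ici 0 \ {t}] t) :
    Tendsto (fun r => |r - t|⁻¹ * (1 - Real.exp (-(laplaceExponent b ν n (max r t)
      - laplaceExponent b ν n (min r t))))) l
      (𝓝 (n * derivWithin b (Ici 0) t + levyExponent ν n t)) := by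
  set Φ := laplaceExponent b ν n
  have hslope : Tendsto (slope Φ t) l (𝓝 (n * derivWithin b (Ici 0) t + levyExponent ν n t)) :=
    (hasDerivWithinAt_iff_tendsto_slope.1 (hν.hasDerivWithinAt_laplaceExponent n ht)).mono_left hl
  have hD : ∀ r, Φ (max r t) - Φ (min r t) = |r - t| * slope Φ t r := fun r => by
    rcases lt_trichotomy r t with h | rfl | h
    · rw [max_eq_right h.le, min_eq_left h.le, slope_def_field, abs_of_neg (sub_neg.2 h)]
      have : r - t ≠ 0 := (sub_neg.2 h).ne
      field_simp
      ring
    · simp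
    · rw [max_eq_left h.le, min_eq_right h.le, slope_def_field, abs_of_pos (sub_pos.2 h)]
      have : r - t ≠ 0 := (sub_pos.2 h).ne'
      field_simp
  -- `1 - e^{-y} = y k(y)` with `k` continuous at `0` and `k(0) = 1`
  let k : ℝ → ℝ := dslope (fun y => 1 - Real.exp (-y)) 0
  have hder := hasDerivAt_one_sub_exp_neg
  have hk0 : k 0 = 1 := by rw [← hder.deriv]; exact dslope_same _ _
  have hk : ContinuousAt k 0 := continuousAt_dslope_same.2 hder.differentiableAt
  have hky : ∀ y, 1 - Real.exp (-y) = y * k y := fun y => by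
    have := sub_smul_dslope (fun y => 1 - Real.exp (-y)) 0 y
    simpa using this.symm
  have hl0 : Tendsto (fun r => |r - t|) l (𝓝 0) := by
    have : Continuous fun r : ℝ => |r - t| := by fun_prop
    simpa using (this.tendsto t).mono_left (hl.trans nhdsWithin_le_nhds)
  have hD0 : Tendsto (fun r => |r - t| * slope Φ t r) l (𝓝 0) := by
    simpa using hl0.mul hslope
  have hkl : Tendsto (fun r => k (|r - t| * slope Φ t r)) l (𝓝 1) := by
    rw [← hk0]
    exact hk.tendsto.comp hD0
  have hfin := hslope.mul hkl
  rw [mul_one] at hfin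
  refine hfin.congr' ?_
  filter_upwards [hl self_mem_nhdsWithin] with r hr
  have hr0 : |r - t| ≠ 0 := abs_ne_zero.2 (sub_ne_zero.2 hr.2)
  rw [hD, hky, ← mul_assoc, ← mul_assoc, inv_mul_cancel₀ hr0, one_mul]

theorem IsAdmissible.continuousOn_laplaceExponent (hν : IsAdmissible b ν) (n : ℕ) :
    ContinuousOn (laplaceExponent b ν n) (Ici 0) :=
  fun _ ht => (hν.hasDerivWithinAt_laplaceExponent n ht).continuousWithinAt

end Exponent

/-! ### The propagator and its derivative -/

section Tilted

variable {E : Type*} [NormedAddCommGroup E] [NormedSpace ℝ E]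

theorem one_sub_exp_neg_nonneg {x : ℝ} (hx : 0 ≤ x) : 0 ≤ 1 - Real.exp (-x) := by simpa using hx

/-- The measure `h⁻¹ (1 - e^{-x}) μ(dx)`. For `h ≥ 0` it lives on `[0, ∞)`, the density being
truncated to `0` where it is negative. -/
noncomputable def tiltedLaw (μ : Measure ℝ) (h : ℝ) : Measure ℝ :=
  μ.withDensity fun x => ENNReal.ofReal (h⁻¹ * (1 - Real.exp (-x)))

instance isFiniteMeasure_tiltedLaw (μ : Measure ℝ) [IsFiniteMeasure μ] (h : ℝ) :
    IsFiniteMeasure (tiltedLaw μ |h|) := by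
  refine isFiniteMeasure_withDensity (lt_of_le_of_lt (b := ∫⁻ _, ENNReal.ofReal |h|⁻¹ ∂μ)
    (lintegral_mono fun x => ?_) ?_).ne
  · refine ENNReal.ofReal_le_ofReal (mul_le_of_le_one_right (by positivity) ?_)
    have := Real.exp_pos (-x)
    linarith
  · rw [lintegral_const]
    exact ENNReal.mul_lt_top ENNReal.ofReal_lt_top (measure_lt_top _ _)

theorem setIntegral_tiltedLaw (μ : Measure ℝ) {h : ℝ} (hh : 0 ≤ h) (F : ℝ → E) :
    ∫ x in Ici 0, F x ∂(tiltedLaw μ h) = h⁻¹ • ∫ x in Ici 0, (1 - Real.exp (-x)) • F x ∂μ := by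
  rw [tiltedLaw, setIntegral_withDensity_eq_setIntegral_toReal_smul (by fun_prop)
    (Eventually.of_forall fun x => ENNReal.ofReal_lt_top) F measurableSet_Ici, ← integral_smul]
  refine setIntegral_congr_fun measurableSet_Ici fun x hx => ?_
  rw [ENNReal.toReal_ofReal (mul_nonneg (inv_nonneg.2 hh) (one_sub_exp_neg_nonneg hx)), mul_smul]

/-- The measure `d δ₀(dx) + (1 - e^{-x}) ν(dx)` on `[0, ∞)`. -/
noncomputable def tiltedLevy (d : ℝ) (ν : Measure ℝ) : Measure ℝ :=
  ENNReal.ofReal d • Measure.dirac 0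
    + (ν.restrict (Ioi 0)).withDensity fun x => ENNReal.ofReal (1 - Real.exp (-x))

theorem IsAdmissible.isFiniteMeasure_tiltedLevy {b : ℝ → ℝ} {ν : ℝ → Measure ℝ}
    (hν : IsAdmissible b ν) {d t : ℝ} (ht : 0 ≤ t) : IsFiniteMeasure (tiltedLevy d (ν t)) := by
  have : IsFiniteMeasure (ENNReal.ofReal d • Measure.dirac (0 : ℝ)) :=
    Measure.smul_finite _ ENNReal.ofReal_ne_top
  have : IsFiniteMeasure (((ν t).restrict (Ioi 0)).withDensity
      fun x => ENNReal.ofReal (1 - Real.exp (-x))) := by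
    refine isFiniteMeasure_withDensity_ofReal ?_
    simpa using (hν.integrableOn_one_sub_exp 1 ht).2
  rw [tiltedLevy]
  infer_instance

theorem setIntegral_tiltedLevy [CompleteSpace E] {d : ℝ} {ν : Measure ℝ}
    [IsFiniteMeasure (tiltedLevy d ν)] (hd : 0 ≤ d) {F : ℝ → E} (hF : ContinuousOn F (Ici 0))
    {C : ℝ} (hC : ∀ x, 0 ≤ x → ‖F x‖ ≤ C) :
    ∫ x in Ici 0, F x ∂(tiltedLevy d ν)
      = d • F 0 + ∫ x in Ioi 0, (1 - Real.exp (-x)) • F x ∂ν := by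
  have hi : IntegrableOn F (Ici 0) (tiltedLevy d ν) := by
    refine Integrable.of_bound (C := C) (hF.aestronglyMeasurable measurableSet_Ici) ?_
    filter_upwards [ae_restrict_mem measurableSet_Ici] with x hx using hC x hx
  rw [tiltedLevy, IntegrableOn, Measure.restrict_add] at hi
  have hsub : Ioi (0 : ℝ) ∩ Ici 0 = Ioi 0 := inter_eq_self_of_subset_left Ioi_subset_Ici_self
  rw [tiltedLevy, Measure.restrict_add, integral_add_measure hi.left_of_add_measure
    hi.right_of_add_measure, Measure.restrict_smul, integral_smul_measure,
    setIntegral_dirac, if_pos self_mem_Ici, ENNReal.toReal_ofReal hd]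
  congr 1
  rw [setIntegral_withDensity_eq_setIntegral_toReal_smul (by fun_prop)
    (Eventually.of_forall fun x => ENNReal.ofReal_lt_top) F measurableSet_Ici,
    Measure.restrict_restrict measurableSet_Ici, inter_comm, hsub]
  refine setIntegral_congr_fun measurableSet_Ioi fun x hx => ?_
  rw [ENNReal.toReal_ofReal (one_sub_exp_neg_nonneg (le_of_lt hx))]

end Tilted

section Propagator

variable {𝕜 H Ω : Type*} [RCLike 𝕜] [NormedAddCommGroup H] [InnerProductSpace 𝕜 H]
    [NormedSpace ℝ H] [CompleteSpace H] [MeasurableSpace Ω] {P : Measure Ω} [IsProbabilityMeasure P]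
    {b : ℝ → ℝ} {ν : ℝ → Measure ℝ} {e : ℝ → Ω → ℝ} {T : ℝ → H →L[𝕜] H} {A : H →ₗ.[𝕜] H}

theorem subordinate_refl (hT : IsContractionSemigroup T) (t : ℝ) (u : H) :
    subordinate T (incrementLaw P b e) t t u = u := by
  have : incrementLaw P b e t t = Measure.dirac 0 := by
    simp [incrementLaw, Measure.map_const]
  rw [subordinate, this, setIntegral_dirac, if_pos self_mem_Ici, hT.zero]

/-- Joint continuity of the propagator, from the continuity of the Laplace exponents. -/
theorem tendsto_subordinate (hν : IsAdmissible b ν) (he : IsPoissonPointProcess P ν e)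
    (hT : IsContractionSemigroup T) {l : Filter ℝ} {f g : ℝ → ℝ} {s t : ℝ} (hs : 0 ≤ s)
    (hst : s ≤ t) (hfg : ∀ᶠ r in l, 0 ≤ f r ∧ f r ≤ g r) (hf : Tendsto f l (𝓝 s))
    (hg : Tendsto g l (𝓝 t)) (u : H) :
    Tendsto (fun r => subordinate T (incrementLaw P b e) (f r) (g r) u) l
      (𝓝 (subordinate T (incrementLaw P b e) s t u)) := by
  have hfin : ∀ s t, IsFiniteMeasure (incrementLaw P b e s t) := fun s t => by
    rw [incrementLaw]; infer_instance
  refine tendsto_integral_of_tendsto_laplace (fun n => ?_) (hT.continuousOn u)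
    (M := ‖u‖) fun x hx => hT.contraction x hx u
  rw [he.laplace_incrementLaw hν hs hst]
  have hΦ := hν.continuousOn_laplaceExponent n
  have hf' : Tendsto f l (𝓝[Ici 0] s) := tendsto_nhdsWithin_iff.2 ⟨hf, hfg.mono fun r h => h.1⟩
  have hg' : Tendsto g l (𝓝[Ici 0] t) :=
    tendsto_nhdsWithin_iff.2 ⟨hg, hfg.mono fun r h => h.1.trans h.2⟩
  refine ((Real.continuous_exp.tendsto _).comp (((hΦ t (hs.trans hst)).tendsto.comp hg').sub
    ((hΦ s hs).tendsto.comp hf')).neg).congr' ?_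
  filter_upwards [hfg] with r hr
  rw [he.laplace_incrementLaw hν hr.1 hr.2]
  rfl

/-- First-order expansion of the propagator at the diagonal: the measures
`(1 - e^{-w}) μ(dw) / |r - t|` converge weakly to `b'(t) δ₀(dw) + (1 - e^{-w}) ν(dw, t)`. -/
theorem tendsto_subordinate_quotient (hν : IsAdmissible b ν) (he : IsPoissonPointProcess P ν e)
    (hT : IsContractionSemigroup T) {u v : H}
    (h : Tendsto (fun t : ℝ => t⁻¹ • (T t u - u)) (𝓝[>] 0) (𝓝 v)) {t : ℝ} (ht : 0 ≤ t)
    {l : Filter ℝ} (hl : l ≤ 𝓝[Ici 0 \ {t}] t) :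
    Tendsto (fun r => |r - t|⁻¹ •
      (subordinate T (incrementLaw P b e) (min r t) (max r t) u - u)) l
      (𝓝 (derivWithin b (Ici 0) t • v + ∫ x in Ioi 0, (T x u - u) ∂(ν t))) := by
  obtain ⟨M, hM⟩ := exists_bound_generatorQuotient hT h
  have hG := continuousOn_generatorQuotient hT h
  set G := generatorQuotient T u v
  have hd0 : 0 ≤ derivWithin b (Ici 0) t := hν.b_monotone.derivWithin_nonneg
  let ρ : ℝ → Measure ℝ := fun r =>
    tiltedLaw (incrementLaw P b e (min r t) (max r t)) |r - t|
  have hfin0 : ∀ s t, IsFiniteMeasure (incrementLaw P b e s t) := fun s t => by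
    rw [incrementLaw]; infer_instance
  have hfin' := hν.isFiniteMeasure_tiltedLevy (d := derivWithin b (Ici 0) t) ht
  have hmain := tendsto_integral_of_tendsto_laplace (l := l) (ρ := ρ)
    (ρ' := tiltedLevy (derivWithin b (Ici 0) t) (ν t)) (fun n => ?_)
    hG hM
  · rw [setIntegral_tiltedLevy hd0 hG hM, show G 0 = v from if_pos rfl] at hmain
    simp only [ρ, setIntegral_tiltedLaw _ (abs_nonneg _), smul_generatorQuotient hT u v, G] at hmain
    refine hmain.congr' ?_
    filter_upwards [hl self_mem_nhdsWithin] with r hr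
    have hmin : 0 ≤ min r t := le_min hr.1 ht
    have hp := he.isProbabilityMeasure_incrementLaw hν hmin (min_le_max (a := r) (b := t))
    congr 1
    have hres := he.incrementLaw_restrict hν hmin (min_le_max (a := r) (b := t))
    rw [integral_sub (hT.integrableOn _ u) (integrable_const u), hres, integral_const,
      subordinate, hres]
    simp
  · have hexpc : ContinuousOn (fun x : ℝ => Real.exp (-(n * x))) (Ici 0) := by fun_prop
    have hsplit : ∀ x : ℝ, (1 - Real.exp (-x)) • Real.exp (-(n * x))
        = Real.exp (-(n * x)) - Real.exp (-((n + 1 : ℕ) * x)) := fun x => by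
      rw [smul_eq_mul, sub_mul, one_mul, ← Real.exp_add]
      push_cast
      ring_nf
    rw [setIntegral_tiltedLevy hd0 hexpc fun x hx => norm_exp_neg_nat_mul_le_one n hx]
    simp only [ρ, setIntegral_tiltedLaw _ (abs_nonneg _), hsplit]
    have hlim := (hν.tendsto_laplaceExponent_quotient (n + 1) ht hl).sub
      (hν.tendsto_laplaceExponent_quotient n ht hl)
    refine (Tendsto.congr' ?_ hlim).trans (le_of_eq ?_)
    · filter_upwards [hl self_mem_nhdsWithin] with r hr
      have hmin : 0 ≤ min r t := le_min hr.1 ht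
      rw [integral_sub (integrableOn_exp_neg_nat_mul n _)
        (integrableOn_exp_neg_nat_mul (n + 1) _), he.laplace_incrementLaw hν hmin min_le_max,
        he.laplace_incrementLaw hν hmin min_le_max, smul_eq_mul]
      ring
    · congr 1
      have h1 : ∀ x : ℝ, Real.exp (-(n * x)) - Real.exp (-((n + 1 : ℕ) * x))
          = (1 - Real.exp (-((n + 1 : ℕ) * x))) - (1 - Real.exp (-(n * x))) := fun x => by ring
      simp only [h1]
      rw [integral_sub (hν.integrableOn_one_sub_exp (n + 1) ht) (hν.integrableOn_one_sub_exp n ht)]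
      simp only [levyExponent, mul_zero, neg_zero, Real.exp_zero, smul_eq_mul, mul_one]
      push_cast
      ring

variable [IsScalarTower ℝ 𝕜 H]

theorem subordinate_comp (hν : IsAdmissible b ν) (he : IsPoissonPointProcess P ν e)
    (hT : IsContractionSemigroup T) {r s t : ℝ} (hr : 0 ≤ r) (hrs : r ≤ s) (hst : s ≤ t) (u : H) :
    subordinate T (incrementLaw P b e) s t (subordinate T (incrementLaw P b e) r s u)
      = subordinate T (incrementLaw P b e) r t u := by
  have hs := hr.trans hrs
  have := he.isProbabilityMeasure_incrementLaw hν hs hst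
  have := he.isProbabilityMeasure_incrementLaw hν hr hrs
  have := he.isProbabilityMeasure_incrementLaw hν hr (hrs.trans hst)
  refine average_comp hT _ (he.incrementLaw_restrict hν hs hst)
    (he.incrementLaw_restrict hν hr hrs) (fun n => ?_) u
  rw [he.laplace_incrementLaw hν hr (hrs.trans hst), he.laplace_incrementLaw hν hr hrs,
    he.laplace_incrementLaw hν hs hst, ← Real.exp_add]
  ring_nf

/-- The operators of the propagator commute, so they may also be composed in the opposite order. -/
theorem subordinate_comp_swap (hν : IsAdmissible b ν) (he : IsPoissonPointProcess P ν e)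
    (hT : IsContractionSemigroup T) {r s t : ℝ} (hr : 0 ≤ r) (hrs : r ≤ s) (hst : s ≤ t) (u : H) :
    subordinate T (incrementLaw P b e) r s (subordinate T (incrementLaw P b e) s t u)
      = subordinate T (incrementLaw P b e) r t u := by
  have hs := hr.trans hrs
  have := he.isProbabilityMeasure_incrementLaw hν hs hst
  have := he.isProbabilityMeasure_incrementLaw hν hr hrs
  have := he.isProbabilityMeasure_incrementLaw hν hr (hrs.trans hst)
  refine average_comp hT _ (he.incrementLaw_restrict hν hr hrs)
    (he.incrementLaw_restrict hν hs hst) (fun n => ?_) u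
  rw [he.laplace_incrementLaw hν hr (hrs.trans hst), he.laplace_incrementLaw hν hr hrs,
    he.laplace_incrementLaw hν hs hst, ← Real.exp_add]
  ring_nf

/-- By the propagator property, the difference quotient of `r ↦ 𝒯_{s,r} u` at `t` is
`𝒯_{s, min r t}` applied to the difference quotient at the diagonal, for `r` on either side
of `t`. -/
theorem hasDerivWithinAt_subordinate (hν : IsAdmissible b ν) (he : IsPoissonPointProcess P ν e)
    (hT : IsContractionSemigroup T) (hA : IsGenerator T A) {s t : ℝ} (hs : 0 ≤ s) (hst : s ≤ t)
    {u : H} (hu : u ∈ A.domain) :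
    ∃ hq : subordinate T (incrementLaw P b e) s t u ∈ A.domain,
      HasDerivWithinAt (fun r => subordinate T (incrementLaw P b e) s r u)
        (phillips b ν T A t ⟨subordinate T (incrementLaw P b e) s t u, hq⟩) (Ici s) t := by
  have ht := hs.trans hst
  have hp := he.isProbabilityMeasure_incrementLaw hν hs hst
  have hgr : (u, A ⟨u, hu⟩) ∈ A.graph := A.mem_graph ⟨u, hu⟩
  have hgr' := average_mem_graph hT (incrementLaw P b e s t) hA hgr
  have hq : subordinate T (incrementLaw P b e) s t u ∈ A.domain :=
    LinearPMap.mem_domain_iff.2 ⟨_, hgr'⟩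
  have hAq : A ⟨_, hq⟩ = average hT (incrementLaw P b e s t) (A ⟨u, hu⟩) :=
    ((LinearPMap.mem_graph_iff' A).1 hgr').elim fun y hy => by
      obtain ⟨h1, h2⟩ := Prod.mk.inj hy
      rw [← h2]
      congr 1
      exact Subtype.ext h1.symm
  refine ⟨hq, ?_⟩
  have htend := (hA _ _).1 hgr
  -- `v = -f(-A, t) u`; its image under `𝒯_{s,t}` is `-f(-A, t) 𝒯_{s,t} u`
  set v : H := derivWithin b (Ici 0) t • A ⟨u, hu⟩ + ∫ x in Ioi 0, (T x u - u) ∂(ν t) with hv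
  have hphi : phillips b ν T A t ⟨_, hq⟩ = subordinate T (incrementLaw P b e) s t v := by
    change _ = average hT (incrementLaw P b e s t) v
    rw [hv, map_add, ← ContinuousLinearMap.integral_comp_comm _
      (hν.integrableOn_semigroup_sub hT htend ht), phillips, hAq]
    congr 1
    · exact (LinearMap.map_smul_of_tower (average hT (incrementLaw P b e s t) : H →ₗ[𝕜] H) _ _).symm
    · refine setIntegral_congr_fun measurableSet_Ioi fun x hx => ?_
      rw [map_sub, ← average_commute hT _ (le_of_lt hx)]
      rfl
  rw [hphi, hasDerivWithinAt_iff_tendsto_slope]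
  set l := 𝓝[Ici s \ {t}] t with hl
  have hl0 : l ≤ 𝓝[Ici 0 \ {t}] t :=
    nhdsWithin_mono t (sdiff_subset_sdiff_left (Ici_subset_Ici.2 hs))
  have hV := tendsto_subordinate_quotient hν he hT htend ht hl0
  set V : ℝ → H := fun r => |r - t|⁻¹ •
      (subordinate T (incrementLaw P b e) (min r t) (max r t) u - u) with hVdef
  have hmem : ∀ᶠ r in l, s ≤ r ∧ r ≠ t := by
    filter_upwards [self_mem_nhdsWithin] with r hr using ⟨hr.1, hr.2⟩
  have hmin : Tendsto (fun r => min r t) l (𝓝 t) := by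
    have : Continuous fun r : ℝ => min r t := by fun_prop
    simpa using (this.tendsto t).mono_left nhdsWithin_le_nhds
  have hUv := tendsto_subordinate hν he hT hs hst (f := fun _ => s) (g := fun r => min r t)
    (hmem.mono fun r hr => ⟨hs, le_min hr.1 hst⟩) tendsto_const_nhds hmin v
  have hdiff : Tendsto (fun r => subordinate T (incrementLaw P b e) s (min r t) (V r)
      - subordinate T (incrementLaw P b e) s (min r t) v) l (𝓝 0) := by
    refine squeeze_zero_norm' ?_ (tendsto_iff_norm_sub_tendsto_zero.1 hV)
    filter_upwards [hmem] with r hr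
    have := he.isProbabilityMeasure_incrementLaw hν hs (le_min hr.1 hst)
    change ‖average hT (incrementLaw P b e s (min r t)) (V r) - average hT _ v‖ ≤ _
    rw [← map_sub]
    exact norm_average_le hT _ _
  have hsum := hdiff.add hUv
  simp only [sub_add_cancel, zero_add] at hsum
  refine hsum.congr' ?_
  filter_upwards [hmem] with r hr
  have hp' := he.isProbabilityMeasure_incrementLaw hν hs (le_min hr.1 hst)
  have hcomp := subordinate_comp_swap hν he hT hs (le_min hr.1 hst) (min_le_max (a := r) (b := t)) u
  have hval : subordinate T (incrementLaw P b e) s (min r t) (V r) = |r - t|⁻¹ •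
      (subordinate T (incrementLaw P b e) s (max r t) u
        - subordinate T (incrementLaw P b e) s (min r t) u) := by
    rw [← hcomp]
    change average hT (incrementLaw P b e s (min r t)) (V r) = |r - t|⁻¹ •
      (average hT (incrementLaw P b e s (min r t)) _ - average hT _ u)
    rw [← map_sub]
    exact LinearMap.map_smul_of_tower
      (average hT (incrementLaw P b e s (min r t)) : H →ₗ[𝕜] H) _ _
  rw [hval, slope, vsub_eq_sub]
  rcases lt_or_gt_of_ne hr.2 with h | h
  · rw [max_eq_right h.le, min_eq_left h.le, abs_of_neg (sub_neg.2 h), inv_neg, neg_smul,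
      ← smul_neg, neg_sub]
  · rw [max_eq_left h.le, min_eq_right h.le, abs_of_pos (sub_pos.2 h)]

theorem isPropagator_subordinate (hν : IsAdmissible b ν) (he : IsPoissonPointProcess P ν e)
    (hT : IsContractionSemigroup T) :
    IsPropagator 𝕜 (subordinate T (incrementLaw P b e)) where
  map_add s t hs hst u v := by
    have := he.isProbabilityMeasure_incrementLaw hν hs hst
    exact map_add (average hT (incrementLaw P b e s t)) u v
  map_smul s t hs hst c u := by
    have := he.isProbabilityMeasure_incrementLaw hν hs hst
    exact map_smul (average hT (incrementLaw P b e s t)) c u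
  refl t _ u := subordinate_refl hT t u
  comp r s t hr hrs hst u := subordinate_comp hν he hT hr hrs hst u
  continuous_left t _ u s hs := by
    refine tendsto_subordinate hν he hT hs.1 hs.2 ?_
      (tendsto_id.mono_left nhdsWithin_le_nhds) tendsto_const_nhds u
    filter_upwards [self_mem_nhdsWithin] with r hr using hr
  continuous_right s hs u t ht := by
    refine tendsto_subordinate hν he hT hs ht ?_ tendsto_const_nhds
      (tendsto_id.mono_left nhdsWithin_le_nhds) u
    filter_upwards [self_mem_nhdsWithin] with r hr using ⟨hs, hr⟩

end Propagator

end NonhomSub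

theorem theorem4p1 {𝕜 H Ω : Type*} [RCLike 𝕜] [NormedAddCommGroup H] [InnerProductSpace 𝕜 H]
    [NormedSpace ℝ H] [IsScalarTower ℝ 𝕜 H] [CompleteSpace H]
    [MeasurableSpace Ω] (P : Measure Ω) [IsProbabilityMeasure P]
    (b : ℝ → ℝ) (ν : ℝ → Measure ℝ) (hν : NonhomSub.IsAdmissible b ν)
    (e : ℝ → Ω → ℝ) (he : NonhomSub.IsPoissonPointProcess P ν e)
    (T : ℝ → H →L[𝕜] H) (hT : NonhomSub.IsContractionSemigroup T)
    (A : H →ₗ.[𝕜] H) (hA : NonhomSub.IsGenerator T A)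
    (hsa : IsSelfAdjoint A) (hdiss : NonhomSub.IsDissipative A) :
    (∀ s t, 0 ≤ s → s ≤ t → ∀ u : H,
      IntegrableOn (fun w => T w u) (Ici 0) (NonhomSub.incrementLaw P b e s t)) ∧
    NonhomSub.IsPropagator 𝕜 (NonhomSub.subordinate T (NonhomSub.incrementLaw P b e)) ∧
    (∀ s t, 0 ≤ s → s ≤ t → ∀ u : H,
      ‖NonhomSub.subordinate T (NonhomSub.incrementLaw P b e) s t u‖ ≤ ‖u‖) ∧
    (∀ t, 0 ≤ t → ∀ q ∈ A.domain, IntegrableOn (fun x => T x q - q) (Ioi 0) (ν t)) ∧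
    (∀ s, 0 ≤ s → ∀ u ∈ A.domain,
      NonhomSub.subordinate T (NonhomSub.incrementLaw P b e) s s u = u ∧
      ∀ t, s ≤ t →
        ∃ hq : NonhomSub.subordinate T (NonhomSub.incrementLaw P b e) s t u ∈ A.domain,
          HasDerivWithinAt
            (fun r => NonhomSub.subordinate T (NonhomSub.incrementLaw P b e) s r u)
            (NonhomSub.phillips b ν T A t
              ⟨NonhomSub.subordinate T (NonhomSub.incrementLaw P b e) s t u, hq⟩)
            (Ici s) t) := by
  refine ⟨fun s t hs hst u => ?_, NonhomSub.isPropagator_subordinate hν he hT,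
    fun s t hs hst u => ?_, fun t ht q hq => ?_, fun s hs u hu =>
    ⟨NonhomSub.subordinate_refl hT s u, fun t hst =>
      NonhomSub.hasDerivWithinAt_subordinate hν he hT hA hs hst hu⟩⟩
  · have := he.isProbabilityMeasure_incrementLaw hν hs hst
    exact hT.integrableOn _ u
  · have := he.isProbabilityMeasure_incrementLaw hν hs hst
    exact NonhomSub.norm_average_le hT (NonhomSub.incrementLaw P b e s t) u
  · exact hν.integrableOn_semigroup_sub hT ((hA _ _).1 (A.mem_graph ⟨q, hq⟩)) ht
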